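/- **Theorem (Decomposition Theorem).** All logarithms are to base $2$. Let $\mathcal M$ be a matroid on a finite ground set and let $n_0\ge 1$ be an integer. *Notation.* For a set $S$ of elements of $\mathcal M$ let $\alpha(S)$ be the least integer $l\ge 0$ such that a uniformly random $l$-element subset of $S$ is independent with probability at most $1/2$ (with $\alpha(S)=|S|+1$ if $S$ is independent). For an ordering $\pi$ of the ground set $E'$ of a matroid $\mathcal M'$ in which $E'$ is dependent, let $C_\pi$ be the unique circuit contained in the shortest dependent prefix of $\pi$; if $E'$ is independent, $C_\pi$ does not exist. Given $n_0^{10}$ independent uniformly random orderings of $E'$, let $\widehat q(S)$ be the fraction of those whose $C_\pi$ exists and is contained in $S$. *FindGreedilyOptimal*$(\mathcal M')$, for a matroid $\mathcal M'$ with ground set $E'$, $n'=|E'|$: draw $n_0^{10}$ independent uniformly random orderings of $E'$. Start with $S=E'$. As long as there is $x\in S$ with $$\widehat q(S\setminus\{x\})\ \ge\ 1-2^{-20}+\frac{\sum_{i=1}^{|S|-1}1/i}{2^{20}\log n'},$$ remove the first such $x$ (in a fixed linear order) from $S$. Return $S$. *IterativePeel*$(\mathcal M)$: fix an arbitrary labelling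 of the elements by distinct integers. Delete from $\mathcal M$ every element $x$ that has the smallest label in some dependent set $S$ with $1\le |S|\le 50$ such that $S\setminus\{x\}$ is independent (this destroys all circuits of size at most $50$); call the result $\mathcal M'$. For $k=1,2,\dots$, as long as the ground set $E'$ of $\mathcal M'$ is non-empty, let $S_k$ be the result of FindGreedilyOptimal$(\mathcal M')$, with fresh randomness; if $\alpha(S_k)/|S_k|\ge 1/\log |E'|$ or $|S_k|>|E'|/2$, stop and return $S_1,\dots,S_{k-1}$; otherwise replace $\mathcal M'$ by $\mathcal M'\setminus S_k$ and continue. When the ground set is empty, return all the sets found. *Claim.* There are absolute constants $c,C>0$ and $N_0$ such that for every matroid $\mathcal M$ on $n$ elements, every labelling and linear order as above, and every $n_0\ge\max(n,N_0)$, with probability at least $1-2^{-n_0}$ the sequence $S_1,\dots,S_k$ returned by IterativePeel$(\mathcal M)$ has all of the following properties. 1. For all $i<j$ with $|S_i|\le 2|S_j|$, $$\alpha(S_j)\ \ge\ \frac{\alpha(S_i)\,|S_j|}{|S_i|}+\frac{1}{5\sqrt2}\sqrt{\frac{\alpha(S_i)\,|S_j|}{|S_i|}}.$$ 2. For every integer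 $\ell\ge 0$, let $T=\{i\in[k] : 2^\ell\le|S_i|\le 2^{\ell+1}-1\}$ and $\gamma=|T|$. If $T\neq\emptyset$ and $a_\gamma$ is the largest index in $T$, then $\alpha(S_{a_\gamma})\ge c\,\gamma^2$. Moreover $\gamma\le C\sqrt{2^\ell}$. 3. $k\le C\,n^{1/3}$. -/

import Mathlib

open scoped ENNReal

namespace MatroidPeel

noncomputable section

variable {α : Type*} [Fintype α] [LinearOrder α]

open scoped Classical in
/-- The ground set `E` of a matroid on a finite type, as a `Finset`. -/
def ground (M : Matroid α) : Finset α := Finset.univ.filter (fun x => x ∈ M.E)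

/-- A permutation of a finite set `E`: a bijection from `{0, …, |E| - 1}` to `E`. -/
abbrev Ordering (E : Finset α) : Type _ := Fin E.card ≃ {x // x ∈ E}

instance (E : Finset α) : Nonempty (Ordering E) := ⟨E.equivFin.symm⟩

/-- The set of the first `j` elements in the order `π`. -/
def firstElems {E : Finset α} (π : Ordering E) (j : ℕ) : Finset α :=
  (Finset.univ.filter (fun i : Fin E.card => (i : ℕ) < j)).image (fun i => (π i : α))

open scoped Classical in
/-- The positions `t` at which adding the elements in the order `π` turns an independent set
into a dependent one. There is exactly one if the ground set is dependent, and none otherwise. -/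
def breakPositions (M : Matroid α) (π : Ordering (ground M)) : Finset (Fin (ground M).card) :=
  Finset.univ.filter (fun t =>
    M.Indep (firstElems π (t : ℕ)) ∧ ¬ M.Indep (firstElems π ((t : ℕ) + 1)))

open scoped Classical in
/-- The first circuit that appears when the elements are added in the order `π`:
with `t` the first break position and `S` the set of elements before it, it consists of `π t` and
of all `π i`, `i < t`, such that `S - π i + π t` is independent.
The value is `none` if no circuit ever appears, i.e. if the whole ground set is independent. -/
def findCircuit (M : Matroid α) (π : Ordering (ground M)) : Option (Finset α) :=
  if h : (breakPositions M π).Nonempty then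
    let t := (breakPositions M π).min' h
    some (insert (π t : α)
      ((firstElems π (t : ℕ)).filter (fun y =>
        M.Indep (insert (π t : α) ((firstElems π (t : ℕ)).erase y) : Finset α))))
  else none

open scoped Classical in
/-- The estimate `q̂(S)`: the fraction of the sampled permutations whose first circuit exists and is
contained in `S`. -/
def estQ (M : Matroid α) {N : ℕ} (ω : Fin N → Ordering (ground M)) (S : Finset α) : ℝ :=
  ((Finset.univ.filter (fun i : Fin N => ∃ C, findCircuit M (ω i) = some C ∧ C ⊆ S)).card : ℝ) / N

/-- The threshold `1 - 2⁻²⁰ + (∑_{i=1}^m 1/i) / (2²⁰ log₂ n)`. -/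
def threshold (n m : ℕ) : ℝ :=
  1 - 1 / 2 ^ 20 + (∑ i ∈ Finset.Icc 1 m, 1 / (i : ℝ)) / (2 ^ 20 * Real.logb 2 n)

open scoped Classical in
/-- Repeatedly delete from `S` the first element `x` for which the estimate of `S - x` still reaches
the threshold for `|S| - 1`, until there is none. -/
def shrink (n : ℕ) (q : Finset α → ℝ) (S : Finset α) : Finset α :=
  if h : (S.filter (fun x => threshold n (S.card - 1) ≤ q (S.erase x))).Nonempty then
    shrink n q
      (S.erase ((S.filter (fun x => threshold n (S.card - 1) ≤ q (S.erase x))).min' h))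
  else S
termination_by S.card
decreasing_by
  exact Finset.card_erase_lt_of_mem (Finset.mem_filter.1 (Finset.min'_mem _ h)).1

/-- `FindGreedilyOptimal`: draw `n₀ ^ 10` independent uniform permutations of the ground set `E`
(a uniform point of the product), and shrink `E` with respect to the resulting estimates. -/
def findGreedilyOptimal (n₀ : ℕ) (M : Matroid α) : PMF (Finset α) :=
  (PMF.uniformOfFintype (Fin (n₀ ^ 10) → Ordering (ground M))).map
    (fun ω => shrink (ground M).card (estQ M ω) (ground M))

open scoped Classical in
/-- The probability that a uniformly random `l`-element subset of `S` is independent. -/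
def indepProb (M : Matroid α) (S : Finset α) (l : ℕ) : ℝ :=
  (((S.powersetCard l).filter (fun T => M.Indep (T : Set α))).card : ℝ) / (S.powersetCard l).card

/-- `α(S)`: the least `l` such that a random `l`-element subset of `S` is independent with
probability at most `1/2` (this is `|S| + 1` if `S` is independent). -/
def alpha (M : Matroid α) (S : Finset α) : ℕ := sInf {l : ℕ | indepProb M S l ≤ 1 / 2}

/-- `RemoveSmallCircuits`, with respect to an injective labelling `π`: delete every `x` that is the
`π`-smallest element of a set `S` of at most `50` elements such that `S` is dependent and `S - x` is
independent. -/
def removeSmallCircuits (π : α ↪ ℕ) (M : Matroid α) : Matroid α :=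
  M.delete {x | ∃ S : Finset α, S ⊆ ground M ∧ S.card ∈ Finset.Icc 1 50 ∧
    x ∈ S ∧ (∀ y ∈ S, π x ≤ π y) ∧ M.Indep (S.erase x : Finset α) ∧ ¬ M.Indep (S : Set α)}

open scoped Classical in
/-- The main loop of `IterativePeel`, run for at most the given number of iterations. In each
iteration `n` is the size of the current ground set, a set `S` is found and peeled off, and the loop
stops without returning `S` if `α(S) / |S| ≥ 1 / log₂ n` or `|S| > n / 2`. -/
def peelLoop (n₀ : ℕ) : ℕ → Matroid α → PMF (List (Finset α))
  | 0, _ => PMF.pure []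
  | fuel + 1, M =>
    if M.E = ∅ then PMF.pure []
    else (findGreedilyOptimal n₀ M).bind (fun S =>
      if 1 / Real.logb 2 ((ground M).card : ℝ) ≤ (alpha M S : ℝ) / (S.card : ℝ) ∨
          ((ground M).card : ℝ) / 2 < (S.card : ℝ) then PMF.pure []
      else (peelLoop n₀ fuel (M.delete (S : Set α))).map (fun L => S :: L))

/-- `IterativePeel`: the law of the list `[S₁, …, S_k]` of the returned sets. Every iteration deletes
at least one element, so `|E|` iterations exhaust the ground set. -/
def iterativePeel (n₀ : ℕ) (π : α ↪ ℕ) (M : Matroid α) : PMF (List (Finset α)) :=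
  peelLoop n₀ (ground M).card (removeSmallCircuits π M)

/-- The indices `i` with `|S_i| ∈ [2^l, 2^(l+1) - 1]`. -/
def sizeClass (L : List (Finset α)) (l : ℕ) : Finset (Fin L.length) :=
  Finset.univ.filter (fun i => (L.get i).card ∈ Finset.Icc (2 ^ l) (2 ^ (l + 1) - 1))

/-- Growth of `α` along the list of peeled sets. -/
def AlphaGrowth (M : Matroid α) (L : List (Finset α)) : Prop :=
  ∀ i j : Fin L.length, i < j → (L.get i).card ≤ 2 * (L.get j).card →
    (alpha M (L.get i) : ℝ) * (L.get j).card / (L.get i).card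
      + 1 / (5 * √2) * √((alpha M (L.get i) : ℝ) * (L.get j).card / (L.get i).card)
      ≤ (alpha M (L.get j) : ℝ)

end

end MatroidPeel

namespace MatroidPeel

set_option linter.unusedSectionVars false

/-! ### Anti-concentration of the hypergeometric distribution -/

/-! With overwhelming probability every peeled set `S` captures the first circuit of a random
ordering with probability at least `1 - 2⁻¹⁸`. The estimate demands `1 - 2⁻²⁰`, so a non-capturing
set passes only after a large deviation, which a union bound over all subsets and all iterations
excludes (`findGreedilyOptimal_failure`, `peelLoop_failure`). An unshrunk ground set is no
exception: it has more than half of the elements, and the loop stops.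

Capturing forces growth (`alpha_growth_of_captures`). Let `T` be disjoint from a capturing `S`, and
put `a = α(S)`, `b = α(T)`. The first `a + b - 1` elements of `S ∪ T` in a random ordering form a
uniform subset `W`. If at least `b` of them lie in `T`, fewer than `a` lie in `S`; conditionally on
the sizes, `W ∩ T` is dependent and `W ∩ S` independent with probability at least `1/4`. Then a
circuit has already appeared, yet none lies in `W ∩ S`, so the first circuit escapes `S`. If `b`
were below the claimed bound, `|W ∩ T| ≥ b` would have probability at least `1/32897`
(`hypergeometric_upper_tail`), and `4 * 32897 < 2 ^ 18` gives a contradiction.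

Within one dyadic size class, growth raises the square root of the normalized density `α(S) / |S|`
by a constant at each step (`sqrt_density_step`). So `γ` sets force `α` of order `γ²`, while `α ≤
|S| / 9` bounds `γ` by a multiple of `√(2^ℓ)`. Counting sets larger than about `n^(2/3)` by
disjointness and the others by size classes gives `k = O(n^(1/3))`. -/

theorem pow_mul_le_of_step {p : ℕ → ℝ} {r : ℝ} (hr : 0 ≤ r) {h k : ℕ}
    (hp : ∀ i, h ≤ i → i < h + k → r * p i ≤ p (i + 1)) : r ^ k * p h ≤ p (h + k) := by
  induction k with
  | zero => simp
  | succ k ih =>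
    have h1 := ih (fun i hi hik => hp i hi (by omega))
    calc r ^ (k + 1) * p h = r * (r ^ k * p h) := by ring
      _ ≤ r * p (h + k) := mul_le_mul_of_nonneg_left h1 hr
      _ ≤ p (h + (k + 1)) := hp (h + k) (by omega) (by omega)

theorem sum_le_sum_of_shift {p : ℕ → ℝ} (hp0 : ∀ i, 0 ≤ p i) {s t : Finset ℕ} {k : ℕ} {R : ℝ}
    (hR : 0 ≤ R) (hst : ∀ h ∈ s, h + k ∈ t) (hp : ∀ h ∈ s, p h ≤ R * p (h + k)) :
    ∑ h ∈ s, p h ≤ R * ∑ h ∈ t, p h := by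
  calc ∑ h ∈ s, p h ≤ ∑ h ∈ s, R * p (h + k) := Finset.sum_le_sum hp
    _ = R * ∑ h ∈ s, p (h + k) := by rw [Finset.mul_sum]
    _ = R * ∑ h ∈ s.map (addRightEmbedding k), p h := by simp
    _ ≤ R * ∑ h ∈ t, p h := by
        refine mul_le_mul_of_nonneg_left ?_ hR
        refine Finset.sum_le_sum_of_subset_of_nonneg ?_ (fun i _ _ => hp0 i)
        intro x hx
        obtain ⟨h, hh, rfl⟩ := Finset.mem_map.1 hx
        exact hst h hh

/-- If a nonnegative sequence does not decrease too fast up to `b + k`, and increases at rate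
`1 + 1 / k` before `b - k`, then the window `[b, b + k)` carries a constant fraction of the
sum over `[0, b)`. -/
theorem sum_range_le_of_ratio {p : ℕ → ℝ} (hp0 : ∀ i, 0 ≤ p i) {b k : ℕ} (hk : 1 ≤ k) {w : ℝ}
    (hw : 0 ≤ w)
    (h1 : ∀ h, h + 2 ≤ b + k → p h ≤ (1 + w) * p (h + 1))
    (h2 : ∀ h, h + k + 1 ≤ b → (1 + 1 / (k : ℝ)) * p h ≤ p (h + 1)) :
    ∑ h ∈ Finset.range b, p h ≤
      (2 * ((1 + w) ^ k) ^ 2 + (1 + w) ^ k) * ∑ h ∈ Finset.Ico b (b + k), p h := by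
  set R := (1 + w) ^ k with hR
  have hR0 : 0 < R := by positivity
  have hk0 : (0 : ℝ) < k := by exact_mod_cast hk
  have hRs : ∀ h, h < b → p h ≤ R * p (h + k) := by
    intro h hh
    have := pow_mul_le_of_step (p := p) (r := (1 + w)⁻¹) (by positivity) (h := h) (k := k)
      (fun i _ hi => by
        rw [inv_mul_le_iff₀ (by positivity)]
        exact h1 i (by omega))
    rwa [inv_pow, inv_mul_le_iff₀ hR0] at this
  have h2s : ∀ h, h + 2 * k ≤ b → p h ≤ (1 / 2) * p (h + k) := by
    intro h hh
    have := pow_mul_le_of_step (p := p) (r := 1 + 1 / (k : ℝ)) (by positivity) (h := h) (k := k)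
      (fun i _ hi => h2 i (by omega))
    have hB : (2 : ℝ) ≤ (1 + 1 / (k : ℝ)) ^ k := by
      have := one_add_mul_le_pow (a := 1 / (k : ℝ)) (by have : 0 ≤ 1 / (k : ℝ) := by positivity
                                                        linarith) k
      have e : (k : ℝ) * (1 / k) = 1 := by field_simp
      linarith
    nlinarith [hp0 h]
  have split1 : ∑ h ∈ Finset.range b, p h =
      ∑ h ∈ Finset.range (b - k), p h + ∑ h ∈ Finset.Ico (b - k) b, p h :=
    (Finset.sum_range_add_sum_Ico _ (by omega)).symm
  have split2 : ∑ h ∈ Finset.range (b - k), p h =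
      ∑ h ∈ Finset.range (b - 2 * k), p h + ∑ h ∈ Finset.Ico (b - 2 * k) (b - k), p h :=
    (Finset.sum_range_add_sum_Ico _ (by omega)).symm
  -- Far below `b`, a shift by `k` at least doubles the terms, so the part before `b - 2k` is at
  -- most the next block of length `k`. Two further shifts, each costing a factor `R`, carry that
  -- block into the window.
  have hX : ∑ h ∈ Finset.range (b - 2 * k), p h ≤ (1 / 2) * ∑ h ∈ Finset.range (b - k), p h :=
    sum_le_sum_of_shift hp0 (k := k) (by norm_num)
      (fun h hh => by simp only [Finset.mem_range] at *; omega)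
      (fun h hh => h2s h (by simp only [Finset.mem_range] at *; omega))
  have hY : ∑ h ∈ Finset.Ico (b - 2 * k) (b - k), p h ≤ R * ∑ h ∈ Finset.Ico (b - k) b, p h :=
    sum_le_sum_of_shift hp0 (k := k) hR0.le
      (fun h hh => by simp only [Finset.mem_Ico] at *; omega)
      (fun h hh => hRs h (by simp only [Finset.mem_Ico] at *; omega))
  have hA : ∑ h ∈ Finset.Ico (b - k) b, p h ≤ R * ∑ h ∈ Finset.Ico b (b + k), p h :=
    sum_le_sum_of_shift hp0 (k := k) hR0.le
      (fun h hh => by simp only [Finset.mem_Ico] at *; omega)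
      (fun h hh => hRs h (by simp only [Finset.mem_Ico] at *; omega))
  have hRA := mul_le_mul_of_nonneg_left hA hR0.le
  nlinarith

theorem choose_mul_choose_step (s t d h : ℕ) (hd : h + 1 ≤ d) (ht : h ≤ t) (hs : d ≤ s + h + 1) :
    ((t.choose (h + 1) : ℝ) * s.choose (d - (h + 1))) * ((h + 1) * (s - d + h + 1)) =
      ((t.choose h : ℝ) * s.choose (d - h)) * ((t - h) * (d - h)) := by
  have e1 : (t.choose (h + 1) : ℝ) * (h + 1) = t.choose h * (t - h) := by
    have := Nat.choose_succ_right_eq t h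
    rw [← Nat.cast_sub ht]
    exact_mod_cast this
  have e2 : (s.choose (d - h) : ℝ) * (d - h) = s.choose (d - (h + 1)) * (s - d + h + 1) := by
    have := Nat.choose_succ_right_eq s (d - (h + 1))
    rw [show d - (h + 1) + 1 = d - h by omega] at this
    have c1 : ((d - h : ℕ) : ℝ) = d - h := by rw [Nat.cast_sub (by omega)]
    have c2 : ((s - (d - (h + 1)) : ℕ) : ℝ) = s - d + h + 1 := by
      rw [Nat.cast_sub (by omega), Nat.cast_sub (by omega)]
      push_cast; ring
    rw [← c1, ← c2]
    exact_mod_cast this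
  linear_combination (s.choose (d - (h + 1)) : ℝ) * (s - d + h + 1) * e1 -
    (t.choose h : ℝ) * (t - h) * e2

theorem choose_mul_choose_le (s t d h : ℕ) (hd : h + 1 ≤ d) (ht : h + 1 ≤ t) {c c' : ℝ}
    (hc' : 0 ≤ c')
    (hh : c * (((h : ℝ) + 1) * (s - d + h + 1)) ≤ c' * (((t : ℝ) - h) * (d - h))) :
    c * ((t.choose h : ℝ) * s.choose (d - h)) ≤
      c' * ((t.choose (h + 1) : ℝ) * s.choose (d - (h + 1))) := by
  by_cases hs : d ≤ s + h
  · have e := choose_mul_choose_step s t d h hd (by omega) (by omega)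
    have hs' : (0 : ℝ) < s - d + h + 1 := by
      have : (d : ℝ) ≤ s + h := by exact_mod_cast hs
      linarith
    have hpos : (0 : ℝ) < ((h : ℝ) + 1) * (s - d + h + 1) := by positivity
    set P := (t.choose h : ℝ) * s.choose (d - h) with hP
    have hP0 : 0 ≤ P := by positivity
    refine le_of_mul_le_mul_right ?_ hpos
    calc c * P * (((h : ℝ) + 1) * (s - d + h + 1))
        = (c * (((h : ℝ) + 1) * (s - d + h + 1))) * P := by ring
      _ ≤ (c' * (((t : ℝ) - h) * (d - h))) * P := mul_le_mul_of_nonneg_right hh hP0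
      _ = c' * (P * (((t : ℝ) - h) * (d - h))) := by ring
      _ = _ := by rw [← e]; ring
  · rw [Nat.choose_eq_zero_of_lt (show s < d - h by omega)]
    simp only [Nat.cast_zero, mul_zero]
    positivity

/-- A suitable window width: within a constant factor of the standard deviation. -/
theorem exists_window {a m : ℝ} (ha : 51 ≤ a) (hm : 0 < m) (ham : a ≤ 2 * m ^ 2) :
    ∃ k : ℕ, 1 ≤ k ∧ 1.44 * (a * m ^ 2) ≤ (k : ℝ) ^ 2 * (m ^ 2 + a) ∧
      (k : ℝ) ^ 2 * (m ^ 2 + a) ≤ 2.1025 * (a * m ^ 2) := by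
  -- With `m² = a t / s`, about `a + m²` draws each hit `T` with probability `m² / (a + m²)`; `σ²`
  -- is the corresponding binomial variance.
  set σ := √(a * m ^ 2 / (m ^ 2 + a)) with hσ
  have hden : 0 < m ^ 2 + a := by positivity
  have hσ2 : σ ^ 2 * (m ^ 2 + a) = a * m ^ 2 := by
    rw [hσ, Real.sq_sqrt (by positivity)]; field_simp
  have h17 : 17 ≤ σ ^ 2 := by
    rw [hσ, Real.sq_sqrt (by positivity), le_div_iff₀ hden]
    nlinarith
  have hσ0 : 0 ≤ σ := Real.sqrt_nonneg _
  have hσ4 : 4 ≤ σ := by nlinarith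
  -- Since `σ ≥ 4`, rounding up costs at most `0.25 σ`; the constants in the bounds are `1.2²` and
  -- `1.45²`.
  refine ⟨⌈1.2 * σ⌉₊, ?_, ?_, ?_⟩
  · exact Nat.one_le_ceil_iff.2 (by positivity)
  · have := Nat.le_ceil (1.2 * σ)
    rw [← hσ2]
    have h2 : 1.44 * σ ^ 2 ≤ (⌈1.2 * σ⌉₊ : ℝ) ^ 2 := by nlinarith
    nlinarith
  · have := Nat.ceil_lt_add_one (show 0 ≤ 1.2 * σ by positivity)
    have h0 : (⌈1.2 * σ⌉₊ : ℝ) ≤ 1.45 * σ := by linarith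
    rw [← hσ2]
    have h2 : (⌈1.2 * σ⌉₊ : ℝ) ^ 2 ≤ 2.1025 * σ ^ 2 := by
      have : (0 : ℝ) ≤ (⌈1.2 * σ⌉₊ : ℝ) := by positivity
      nlinarith
    nlinarith

/-! ### Numerical inequalities for the window and the term ratios. -/

section Window

variable {a m k δ : ℝ}

theorem window_le (ha : 51 ≤ a) (hm : 0 < m) (hk : 1 ≤ k)
    (hku : k ^ 2 * (m ^ 2 + a) ≤ 2.1025 * (a * m ^ 2)) :
    k ≤ 1.45 * m ∧ k ≤ 0.2031 * a := by
  have h1 : k ^ 2 ≤ 2.1025 * m ^ 2 := by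
    have : k ^ 2 * a ≤ (2.1025 * m ^ 2) * a := by nlinarith [sq_nonneg (k * m)]
    exact le_of_mul_le_mul_right this (by linarith)
  have h2 : k ^ 2 ≤ 2.1025 * a := by
    have : k ^ 2 * m ^ 2 ≤ (2.1025 * a) * m ^ 2 := by nlinarith [sq_nonneg k]
    exact le_of_mul_le_mul_right this (by positivity)
  constructor
  · nlinarith
  · have : k ^ 2 ≤ (0.2031 * a) ^ 2 := by nlinarith
    exact (pow_le_pow_iff_left₀ (by linarith) (by linarith) two_ne_zero).1 this

/-- In units of `a m²`, the left side is below `1.27` and the right side is at least `1.44`. This is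
what growth at rate `1 + 1 / k` before the window needs. -/
theorem window_upper (hδ0 : 0 ≤ δ) (hδ : δ ≤ 0.1415) (ha : 51 ≤ a) (hm : 0 < m)
    (ham : a ≤ 2 * m ^ 2) (hk : 1 ≤ k)
    (hkl : 1.44 * (a * m ^ 2) ≤ k ^ 2 * (m ^ 2 + a))
    (hku : k ^ 2 * (m ^ 2 + a) ≤ 2.1025 * (a * m ^ 2)) :
    δ * m / 8 * (a + k) * k + a * k * δ * m + a * m ^ 2 + a * δ * m ≤ (m ^ 2 + a) * k ^ 2 := by
  obtain ⟨h1, h2⟩ := window_le ha hm hk hku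
  have hm5 : 5 ≤ m := by nlinarith
  have hδm : δ * m ≤ 0.1415 * m := by nlinarith
  have t1 : δ * m / 8 * (a + k) * k ≤ 0.1415 * m / 8 * (a + 0.2031 * a) * (1.45 * m) := by
    gcongr
  have t2 : a * k * δ * m ≤ a * (1.45 * m) * 0.1415 * m := by gcongr
  have t3 : a * δ * m ≤ 0.03 * (a * m ^ 2) := by nlinarith
  nlinarith

/-- In units of `a m²`, the left side adds up to less than `4`. The constant `4.8` is the decay
rate, times `k`, tolerated up to the end of the window. -/
theorem window_lower (hδ0 : 0 ≤ δ) (hδ : δ ≤ 0.1415) (ha : 51 ≤ a) (hm : 0 < m)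
    (ham : a ≤ 2 * m ^ 2) (hk : 1 ≤ k)
    (hku : k ^ 2 * (m ^ 2 + a) ≤ 2.1025 * (a * m ^ 2)) :
    k ^ 2 * (m ^ 2 + a) + 4.8 * k * m ^ 2 + a * k * δ * m
      + 4.8 / 9 * (a - k) * (m ^ 2 + δ * m + k) ≤ 4.8 * (a * m ^ 2) := by
  obtain ⟨h1, h2⟩ := window_le ha hm hk hku
  have hm5 : 5 ≤ m := by nlinarith
  have t1 : 4.8 * k * m ^ 2 ≤ 4.8 * (0.2031 * a) * m ^ 2 := by gcongr
  have t2 : a * k * δ * m ≤ a * (1.45 * m) * 0.1415 * m := by gcongr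
  have t3 : 4.8 / 9 * (a - k) * (m ^ 2 + δ * m + k) ≤
      4.8 / 9 * a * (m ^ 2 + 0.03 * m ^ 2 + 0.29 * m ^ 2) := by
    have : δ * m ≤ 0.03 * m ^ 2 := by nlinarith
    have : k ≤ 0.29 * m ^ 2 := by nlinarith
    gcongr
    · linarith
  nlinarith

end Window

section Ratio

variable {a b s t m k δ : ℝ}

theorem ratio_upper (hδ0 : 0 ≤ δ) (hδ : δ ≤ 0.1415) (ha : 51 ≤ a) (hm : 0 < m)
    (ham : a ≤ 2 * m ^ 2) (hk : 1 ≤ k)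
    (hkl : 1.44 * (a * m ^ 2) ≤ k ^ 2 * (m ^ 2 + a))
    (hku : k ^ 2 * (m ^ 2 + a) ≤ 2.1025 * (a * m ^ 2))
    (hs : 9 * a ≤ s) (hms : m ^ 2 * s = a * t) (hb : b ≤ m ^ 2 + δ * m) :
    (k + 1) * ((b - k) * (s - a)) ≤ k * ((t - b) * (a + k)) := by
  have hw := window_upper hδ0 hδ ha hm ham hk hkl hku
  have ha0 : 0 < a := by linarith
  refine le_of_mul_le_mul_right ?_ ha0
  have e1 : (k + 1) * ((b - k) * (s - a)) * a ≤
      (k + 1) * ((m ^ 2 + δ * m - k) * (s - a)) * a := by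
    have : 0 ≤ s - a := by linarith
    gcongr
  have e2 : k * ((m ^ 2 * s - a * (m ^ 2 + δ * m)) * (a + k)) ≤ k * ((t - b) * (a + k)) * a := by
    rw [hms]
    have : k * ((a * t - a * (m ^ 2 + δ * m)) * (a + k)) ≤ k * ((a * t - a * b) * (a + k)) := by
      gcongr
    linarith
  -- Multiplying by `a` and replacing `a t` by `m² s` makes the difference of the two sides affine
  -- in `s`, with slope `c`; then `s - a ≥ 8 a` absorbs the constant term.
  set c := k * (a + k) * m ^ 2 - (k + 1) * (m ^ 2 + δ * m - k) * a with hc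
  have hc1 : δ * m * k * (a + k) ≤ 8 * c := by
    have : 0 ≤ a * k := by positivity
    rw [hc]; nlinarith
  have hc0 : 0 ≤ c := by
    have : 0 ≤ δ * m * k * (a + k) := by positivity
    linarith
  have hcs : 8 * a * c ≤ (s - a) * c := by gcongr; linarith
  have hac : a * (δ * m * k * (a + k)) ≤ a * (8 * c) := by gcongr
  have : k * ((m ^ 2 * s - a * (m ^ 2 + δ * m)) * (a + k)) -
      (k + 1) * ((m ^ 2 + δ * m - k) * (s - a)) * a = (s - a) * c - a * (δ * m * k * (a + k)) := by
    rw [hc]; ring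
  linarith

theorem ratio_lower (hδ0 : 0 ≤ δ) (hδ : δ ≤ 0.1415) (ha : 51 ≤ a) (hm : 0 < m)
    (ham : a ≤ 2 * m ^ 2) (hk : 1 ≤ k)
    (hku : k ^ 2 * (m ^ 2 + a) ≤ 2.1025 * (a * m ^ 2))
    (hs : 9 * a ≤ s) (hms : m ^ 2 * s = a * t) (hb : b ≤ m ^ 2 + δ * m) :
    k * ((b + k) * (s - a + k)) ≤ (k + 4.8) * ((t - b - k) * (a - k)) := by
  have hw := window_lower hδ0 hδ ha hm ham hk hku
  obtain ⟨-, hka⟩ := window_le ha hm hk hku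
  have ha0 : 0 < a := by linarith
  have hak : 0 ≤ a - k := by linarith
  refine le_of_mul_le_mul_right ?_ ha0
  have e1 : k * ((b + k) * (s - a + k)) * a ≤
      k * ((m ^ 2 + δ * m + k) * (s - a + k)) * a := by
    have : 0 ≤ s - a + k := by linarith
    gcongr
  have e2 : (k + 4.8) * ((m ^ 2 * s - a * (m ^ 2 + δ * m + k)) * (a - k)) ≤
      (k + 4.8) * ((t - b - k) * (a - k)) * a := by
    rw [hms]
    have : (k + 4.8) * ((a * t - a * (m ^ 2 + δ * m + k)) * (a - k)) ≤
        (k + 4.8) * ((a * t - a * (b + k)) * (a - k)) := by gcongr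
    linarith
  set c := (k + 4.8) * (a - k) * m ^ 2 - k * (m ^ 2 + δ * m + k) * a with hc
  have hc1 : 4.8 * (a - k) * (m ^ 2 + δ * m + k) ≤ 9 * c := by
    rw [hc]; nlinarith
  have hc0 : 0 ≤ c := by
    have : 0 ≤ 4.8 * (a - k) * (m ^ 2 + δ * m + k) := by positivity
    linarith
  have hcs : 9 * a * c ≤ s * c := by gcongr
  have hac : a * (4.8 * (a - k) * (m ^ 2 + δ * m + k)) ≤ a * (9 * c) := by gcongr
  have : (k + 4.8) * ((m ^ 2 * s - a * (m ^ 2 + δ * m + k)) * (a - k)) -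
      k * ((m ^ 2 + δ * m + k) * (s - a + k)) * a =
      s * c - a * (4.8 * (a - k) * (m ^ 2 + δ * m + k)) := by
    rw [hc]; ring
  linarith

end Ratio

/-- The bound is `e^4.8 < 128`, checked after raising to the fifth power. With `R ≤ 128`, the loss
`4 (2 R² + R + 1)` stays below `2 ^ 18`. -/
theorem one_add_div_pow_le {k : ℕ} (hk : 1 ≤ k) : (1 + 4.8 / (k : ℝ)) ^ k ≤ 128 := by
  have hk0 : (0 : ℝ) < k := by exact_mod_cast hk
  have h1 : (1 + 4.8 / (k : ℝ)) ^ k ≤ Real.exp 4.8 := by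
    calc (1 + 4.8 / (k : ℝ)) ^ k ≤ Real.exp (4.8 / k) ^ k := by
          gcongr; linarith [Real.add_one_le_exp (4.8 / (k : ℝ))]
      _ = Real.exp 4.8 := by rw [← Real.exp_nat_mul]; congr 1; field_simp
  refine h1.trans ?_
  have h2 : Real.exp 4.8 ^ 5 ≤ 128 ^ 5 := by
    rw [← Real.exp_nat_mul, show ((5 : ℕ) : ℝ) * 4.8 = (24 : ℕ) * 1 by norm_num,
      Real.exp_nat_mul]
    calc Real.exp 1 ^ 24 ≤ 2.7182818286 ^ 24 := by
          gcongr; exact Real.exp_one_lt_d9.le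
      _ ≤ 128 ^ 5 := by norm_num
  exact (pow_le_pow_iff_left₀ (Real.exp_pos _).le (by norm_num) (by norm_num)).1 h2

theorem inv_five_sqrt_two_le : 1 / (5 * √2) ≤ 0.1415 := by
  have h : 1.4142 ≤ √2 := Real.le_sqrt_of_sq_le (by norm_num)
  rw [div_le_iff₀ (by positivity)]
  linarith

/-- Drawing `a + b - 1` elements from `s + t`, the number of draws among the `t` elements is at
least `b` with probability bounded below, when `b` is not too far above `a t / s`. -/
theorem hypergeometric_upper_tail {a b s t : ℕ} (ha : 51 ≤ a) (hb : 1 ≤ b) (has : 9 * a ≤ s)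
    (hbt : 9 * b ≤ t) (hst : s ≤ 2 * t)
    (hlt : (b : ℝ) ≤ (a : ℝ) * t / s + 1 / (5 * √2) * √((a : ℝ) * t / s)) :
    ((s + t).choose (a + b - 1) : ℝ) ≤ 32897 *
      ∑ h ∈ Finset.Ico b (a + b), (t.choose h : ℝ) * s.choose (a + b - 1 - h) := by
  set δ := 1 / (5 * √2) with hδ
  have hδ0 : 0 ≤ δ := by positivity
  have hδ1 : δ ≤ 0.1415 := inv_five_sqrt_two_le
  set m := √((a : ℝ) * t / s) with hm
  have ha' : (51 : ℝ) ≤ a := by exact_mod_cast ha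
  have hb' : (1 : ℝ) ≤ b := by exact_mod_cast hb
  have has' : 9 * (a : ℝ) ≤ s := by exact_mod_cast has
  have hbt' : 9 * (b : ℝ) ≤ t := by exact_mod_cast hbt
  have hst' : (s : ℝ) ≤ 2 * t := by exact_mod_cast hst
  have hs0 : (0 : ℝ) < s := by linarith
  have ht0 : (0 : ℝ) < t := by linarith
  have hm0 : 0 < m := by rw [hm]; positivity
  have hm2 : m ^ 2 = (a : ℝ) * t / s := Real.sq_sqrt (by positivity)
  have hms : m ^ 2 * s = (a : ℝ) * t := by rw [hm2]; field_simp
  have ham : (a : ℝ) ≤ 2 * m ^ 2 := by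
    rw [hm2, ← mul_div_assoc, le_div_iff₀ hs0]; nlinarith only [hst', ha']
  have hbm : (b : ℝ) ≤ m ^ 2 + δ * m := by rw [hm2]; exact hlt
  obtain ⟨k, hk1, hkl, hku⟩ := exists_window ha' hm0 ham
  have hk1' : (1 : ℝ) ≤ k := by exact_mod_cast hk1
  obtain ⟨hkm, hka⟩ := window_le ha' hm0 hk1' hku
  have hka1 : k + 1 ≤ a := by
    have : (k : ℝ) + 1 ≤ a := by linarith
    exact_mod_cast this
  have hkt : b + k ≤ t := by
    have h9 : m ^ 2 * 9 ≤ t := by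
      rw [hm2, div_mul_eq_mul_div, div_le_iff₀ hs0]; nlinarith only [has', ht0]
    have hm5 : 5 ≤ m := by nlinarith only [ham, ha', hm0]
    have h5 : 5 * m ≤ m ^ 2 := by nlinarith only [hm5]
    have : (b : ℝ) + k ≤ t := by linarith only [h9, h5, hkm, hbt', hb']
    exact_mod_cast this
  have hd : ((a + b - 1 : ℕ) : ℝ) = a + b - 1 := by
    rw [Nat.cast_sub (by omega)]; push_cast; ring
  have hup := ratio_upper hδ0 hδ1 ha' hm0 ham hk1' hkl hku has' hms hbm
  have hlo := ratio_lower hδ0 hδ1 ha' hm0 ham hk1' hku has' hms hbm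
  set p : ℕ → ℝ := fun h => (t.choose h : ℝ) * s.choose (a + b - 1 - h) with hp
  have hp0 : ∀ i, 0 ≤ p i := fun i => by positivity
  have hkt' : (b : ℝ) + k ≤ t := by exact_mod_cast hkt
  have hka' : (k : ℝ) + 1 ≤ a := by exact_mod_cast hka1
  have hk0 : (0 : ℝ) < k := by linarith
  have h1 : ∀ h, h + 2 ≤ b + k → p h ≤ (1 + 4.8 / (k : ℝ)) * p (h + 1) := by
    intro h hh
    have hh' : (h : ℝ) + 2 ≤ b + k := by exact_mod_cast hh
    have := choose_mul_choose_le s t (a + b - 1) h (by omega) (by omega) (c := k)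
      (c' := k + 4.8) (by positivity) (by
        rw [hd]
        have h0 : (0 : ℝ) ≤ h := by positivity
        calc (k : ℝ) * (((h : ℝ) + 1) * (s - (a + b - 1) + h + 1))
            ≤ k * ((b + k) * (s - a + k)) := by
              refine mul_le_mul_of_nonneg_left ?_ hk0.le
              calc ((h : ℝ) + 1) * (s - (a + b - 1) + h + 1) ≤ (h + 1) * (s - a + k) :=
                    mul_le_mul_of_nonneg_left (by linarith) (by linarith)
                _ ≤ (b + k) * (s - a + k) :=
                    mul_le_mul_of_nonneg_right (by linarith) (by linarith)
          _ ≤ (k + 4.8) * ((t - b - k) * (a - k)) := hlo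
          _ ≤ (k + 4.8) * (((t : ℝ) - h) * (a + b - 1 - h)) := by
              refine mul_le_mul_of_nonneg_left ?_ (by positivity)
              exact mul_le_mul (by linarith) (by linarith) (by linarith) (by linarith))
    have e : (1 + 4.8 / (k : ℝ)) = (k + 4.8) / k := by field_simp
    rw [e, div_mul_eq_mul_div, le_div_iff₀ hk0]
    linarith
  have h2 : ∀ h, h + k + 1 ≤ b → (1 + 1 / (k : ℝ)) * p h ≤ p (h + 1) := by
    intro h hh
    have hh' : (h : ℝ) + k + 1 ≤ b := by exact_mod_cast hh
    have := choose_mul_choose_le s t (a + b - 1) h (by omega) (by omega) (c := k + 1)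
      (c' := k) (by positivity) (by
        rw [hd]
        have h0 : (0 : ℝ) ≤ h := by positivity
        calc (k + 1 : ℝ) * (((h : ℝ) + 1) * (s - (a + b - 1) + h + 1))
            ≤ (k + 1) * ((b - k) * (s - a)) := by
              refine mul_le_mul_of_nonneg_left ?_ (by positivity)
              calc ((h : ℝ) + 1) * (s - (a + b - 1) + h + 1) ≤ (h + 1) * (s - a) :=
                    mul_le_mul_of_nonneg_left (by linarith) (by linarith)
                _ ≤ (b - k) * (s - a) :=
                    mul_le_mul_of_nonneg_right (by linarith) (by linarith)
          _ ≤ k * ((t - b) * (a + k)) := hup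
          _ ≤ k * (((t : ℝ) - h) * (a + b - 1 - h)) := by
              refine mul_le_mul_of_nonneg_left ?_ (by positivity)
              exact mul_le_mul (by linarith) (by linarith) (by linarith) (by linarith))
    have e : (1 + 1 / (k : ℝ)) = (k + 1) / k := by field_simp
    rw [e, div_mul_eq_mul_div, div_le_iff₀ hk0]
    linarith
  have hmain := sum_range_le_of_ratio hp0 hk1 (w := 4.8 / (k : ℝ)) (by positivity) h1 h2
  have hR := one_add_div_pow_le hk1
  set R := (1 + 4.8 / (k : ℝ)) ^ k
  have hR0 : 0 ≤ R := by positivity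
  have hsub : ∑ h ∈ Finset.Ico b (b + k), p h ≤ ∑ h ∈ Finset.Ico b (a + b), p h :=
    Finset.sum_le_sum_of_subset_of_nonneg
      (Finset.Ico_subset_Ico_right (by omega)) (fun i _ _ => hp0 i)
  have hS0 : 0 ≤ ∑ h ∈ Finset.Ico b (b + k), p h := Finset.sum_nonneg (fun i _ => hp0 i)
  have hvand : ((s + t).choose (a + b - 1) : ℝ) = ∑ h ∈ Finset.range (a + b), p h := by
    rw [add_comm s t, Nat.add_choose_eq,
      Finset.Nat.sum_antidiagonal_eq_sum_range_succ (fun i j => t.choose i * s.choose j)]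
    push_cast
    rw [show (a + b - 1).succ = a + b by omega]
  rw [hvand, ← Finset.sum_range_add_sum_Ico p (show b ≤ a + b by omega)]
  -- Adding `1` for the upper tail itself gives `32897`.
  have hR2 : 2 * R ^ 2 + R ≤ 32896 := by nlinarith only [hR, hR0]
  linarith only [mul_le_mul_of_nonneg_right hR2 hS0, hmain, hsub]

variable {α : Type*} [Fintype α] [LinearOrder α]

/-! ### Prefixes of orderings -/

theorem mem_ground {M : Matroid α} {x : α} : x ∈ ground M ↔ x ∈ M.E := by
  simp [ground]

theorem coe_ground (M : Matroid α) : (ground M : Set α) = M.E := by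
  ext x; simp [mem_ground]

theorem coe_subset_ground {M : Matroid α} {S : Finset α} (h : S ⊆ ground M) :
    (S : Set α) ⊆ M.E := by
  rw [← coe_ground]; exact_mod_cast h

section Prefix

variable {E : Finset α} (π : Ordering E)

theorem mem_firstElems {j : ℕ} {x : α} :
    x ∈ firstElems π j ↔ ∃ i : Fin E.card, (i : ℕ) < j ∧ (π i : α) = x := by
  simp [firstElems]

theorem firstElems_zero : firstElems π 0 = ∅ := by
  ext x; simp [mem_firstElems]

theorem firstElems_mono {i j : ℕ} (h : i ≤ j) : firstElems π i ⊆ firstElems π j := by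
  intro x hx
  rw [mem_firstElems] at *
  obtain ⟨l, hl, rfl⟩ := hx
  exact ⟨l, by omega, rfl⟩

theorem firstElems_subset (j : ℕ) : firstElems π j ⊆ E := by
  intro x hx
  obtain ⟨l, -, rfl⟩ := (mem_firstElems π).1 hx
  exact (π l).2

theorem firstElems_card : firstElems π E.card = E := by
  refine (firstElems_subset π _).antisymm fun x hx => ?_
  exact (mem_firstElems π).2 ⟨π.symm ⟨x, hx⟩, (π.symm ⟨x, hx⟩).2, by simp⟩

theorem firstElems_succ (t : Fin E.card) :
    firstElems π ((t : ℕ) + 1) = insert (π t : α) (firstElems π t) := by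
  ext x
  simp only [Finset.mem_insert, mem_firstElems]
  constructor
  · rintro ⟨i, hi, rfl⟩
    by_cases h : (i : ℕ) = t
    · left; rw [Fin.ext h]
    · right; exact ⟨i, by omega, rfl⟩
  · rintro (rfl | ⟨i, hi, rfl⟩)
    · exact ⟨t, by omega, rfl⟩
    · exact ⟨i, by omega, rfl⟩

theorem notMem_firstElems (t : Fin E.card) : (π t : α) ∉ firstElems π t := by
  rw [mem_firstElems]
  rintro ⟨i, hi, h⟩
  have := π.injective (Subtype.ext h)
  subst this
  exact lt_irrefl _ hi

theorem firstElems_succ_of_card_le {j : ℕ} (h : E.card ≤ j) :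
    firstElems π (j + 1) = firstElems π j := by
  refine Finset.Subset.antisymm ?_ (firstElems_mono π (by omega))
  refine (firstElems_subset π _).trans ?_
  conv_lhs => rw [← firstElems_card π]
  exact firstElems_mono π h

theorem card_firstElems_succ_inter_le (U : Finset α) (j : ℕ) :
    (firstElems π (j + 1) ∩ U).card ≤ (firstElems π j ∩ U).card + 1 := by
  by_cases h : j < E.card
  · have := firstElems_succ π ⟨j, h⟩
    simp only at this
    rw [this]
    refine (Finset.card_le_card (t := insert (π ⟨j, h⟩ : α) (firstElems π j ∩ U)) ?_).trans
      (Finset.card_insert_le _ _)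
    intro x
    simp only [Finset.mem_inter, Finset.mem_insert]
    tauto
  · rw [firstElems_succ_of_card_le π (by omega)]
    omega

/-- Discrete intermediate values: the count starts at `0` and rises by at most one per element. -/
theorem exists_card_firstElems_inter {U : Finset α} (hU : U ⊆ E) {D : ℕ} (hD : D ≤ U.card) :
    ∃ j, (firstElems π j ∩ U).card = D := by
  classical
  have hex : ∃ j, D ≤ (firstElems π j ∩ U).card :=
    ⟨E.card, by rwa [firstElems_card, Finset.inter_eq_right.2 hU]⟩
  refine ⟨Nat.find hex, le_antisymm ?_ (Nat.find_spec hex)⟩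
  rcases h : Nat.find hex with _ | i
  · simp [firstElems_zero]
  · have h1 := Nat.find_min hex (m := i) (by omega)
    have h2 := card_firstElems_succ_inter_le π U i
    omega

theorem firstElems_inter_eq_of_card_eq {U : Finset α} {i j : ℕ}
    (h : (firstElems π i ∩ U).card = (firstElems π j ∩ U).card) :
    firstElems π i ∩ U = firstElems π j ∩ U := by
  rcases le_total i j with hij | hij
  · exact Finset.eq_of_subset_of_card_le
      (Finset.inter_subset_inter_right (firstElems_mono π hij)) h.ge
  · exact (Finset.eq_of_subset_of_card_le
      (Finset.inter_subset_inter_right (firstElems_mono π hij)) h.le).symm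

open scoped Classical in
/-- The orderings of `E` some prefix of which meets `U` in exactly `W`. -/
noncomputable def orderingsVia (E U W : Finset α) : Finset (Ordering E) :=
  Finset.univ.filter (fun π => ∃ j, firstElems π j ∩ U = W)

theorem mem_orderingsVia {U W : Finset α} {π : Ordering E} :
    π ∈ orderingsVia E U W ↔ ∃ j, firstElems π j ∩ U = W := by
  simp [orderingsVia]

end Prefix

/-- The classes inside `W`, in `U \ W` and outside `U` have the same sizes as those for `W'`, so
bijections between them glue together. -/
theorem exists_perm_of_subset {β : Type*} [Fintype β] [DecidableEq β] {U W W' : Finset β}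
    (hW : W ⊆ U) (hW' : W' ⊆ U) (h : W.card = W'.card) :
    ∃ σ : β ≃ β, (∀ x, σ x ∈ U ↔ x ∈ U) ∧ ∀ x, σ x ∈ W' ↔ x ∈ W := by
  classical
  let f : β → Bool × Bool := fun x => (decide (x ∈ U), decide (x ∈ W))
  let g : β → Bool × Bool := fun x => (decide (x ∈ U), decide (x ∈ W'))
  have hU : (U \ W).card = (U \ W').card := by
    rw [Finset.card_sdiff_of_subset hW, Finset.card_sdiff_of_subset hW', h]
  have key : ∀ c, Fintype.card {x // f x = c} = Fintype.card {x // g x = c} := by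
    rintro ⟨u, w⟩
    rw [Fintype.card_subtype, Fintype.card_subtype]
    cases u <;> cases w
    · congr 1; ext x
      have := @hW x; have := @hW' x
      simp [f, g]; tauto
    · congr 1; ext x
      have := @hW x; have := @hW' x
      simp [f, g]; tauto
    · convert hU using 2 <;> ext x <;> simp [f, g]
    · convert h using 2 <;> ext x
      · have := @hW x
        simp [f]; tauto
      · have := @hW' x
        simp [g]; tauto
  let e : ∀ c, {x // f x = c} ≃ {x // g x = c} := fun c => Fintype.equivOfCardEq (key c)
  have hσ := Equiv.ofFiberEquiv_map e
  refine ⟨Equiv.ofFiberEquiv e, fun x => ?_, fun x => ?_⟩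
  · have := congrArg Prod.fst (hσ x)
    simpa [f, g] using this
  · have := congrArg Prod.snd (hσ x)
    simpa [f, g] using this

/-- Relabelling by a permutation that preserves `U` and carries `W` to `W'` injects one family of
orderings into the other. -/
theorem card_orderingsVia_le {E U W W' : Finset α} (hU : U ⊆ E) (hW : W ⊆ U) (hW' : W' ⊆ U)
    (h : W.card = W'.card) : (orderingsVia E U W).card ≤ (orderingsVia E U W').card := by
  classical
  have hcard : ∀ V ⊆ U, (Finset.univ.filter (fun x : {x // x ∈ E} => (x : α) ∈ V)).card
      = V.card := by
    intro V hV
    rw [← Finset.card_map (Function.Embedding.subtype (· ∈ E))]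
    congr 1; ext x
    have := @hV x; have := @hU x
    simp; tauto
  obtain ⟨σ, hσU, hσW⟩ := exists_perm_of_subset
    (U := Finset.univ.filter (fun x : {x // x ∈ E} => (x : α) ∈ U))
    (W := Finset.univ.filter (fun x : {x // x ∈ E} => (x : α) ∈ W))
    (W' := Finset.univ.filter (fun x : {x // x ∈ E} => (x : α) ∈ W'))
    (Finset.monotone_filter_right _ fun x _ hx => hW hx)
    (Finset.monotone_filter_right _ fun x _ hx => hW' hx)
    (by rw [hcard W hW, hcard W' hW', h])
  simp only [Finset.mem_filter, Finset.mem_univ, true_and] at hσU hσW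
  refine Finset.card_le_card_of_injOn (fun π => π.trans σ) ?_ ?_
  · intro π hπ
    rw [Finset.mem_coe, mem_orderingsVia] at hπ ⊢
    obtain ⟨j, hj⟩ := hπ
    refine ⟨j, ?_⟩
    ext x
    simp only [Finset.mem_inter, mem_firstElems, Equiv.trans_apply]
    constructor
    · rintro ⟨⟨i, hi, rfl⟩, hx⟩
      rw [hσW, ← hj, Finset.mem_inter, mem_firstElems]
      exact ⟨⟨i, hi, rfl⟩, (hσU _).1 hx⟩
    · intro hx
      refine ⟨?_, hW' hx⟩
      have hxE := hU (hW' hx)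
      have hy : ((σ.symm ⟨x, hxE⟩ : {x // x ∈ E}) : α) ∈ W := by
        rw [← hσW]; simpa using hx
      rw [← hj, Finset.mem_inter, mem_firstElems] at hy
      obtain ⟨⟨i, hi, hiy⟩, -⟩ := hy
      refine ⟨i, hi, ?_⟩
      rw [Subtype.ext hiy]; simp
  · intro π _ π' _ hππ
    ext i
    have := congrArg (fun τ : Ordering E => τ i) hππ
    simp only [Equiv.trans_apply] at this
    rw [σ.injective this]

/-- The first `D` elements of `U` in a uniformly random ordering form a uniformly random
`D`-element subset of `U`. -/
theorem card_biUnion_orderingsVia {E U : Finset α} (hU : U ⊆ E) {D : ℕ} (hD : D ≤ U.card)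
    {B : Finset (Finset α)} (hB : B ⊆ U.powersetCard D) :
    (B.biUnion (orderingsVia E U)).card * U.card.choose D =
      B.card * Fintype.card (Ordering E) := by
  classical
  obtain ⟨W₀, hW₀⟩ := Finset.powersetCard_nonempty.2 hD
  have hcard : ∀ W ∈ U.powersetCard D,
      (orderingsVia E U W).card = (orderingsVia E U W₀).card := by
    intro W hW
    rw [Finset.mem_powersetCard] at hW hW₀
    exact le_antisymm (card_orderingsVia_le hU hW.1 hW₀.1 (hW.2.trans hW₀.2.symm))
      (card_orderingsVia_le hU hW₀.1 hW.1 (hW₀.2.trans hW.2.symm))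
  have hdisj : (U.powersetCard D : Set (Finset α)).PairwiseDisjoint (orderingsVia E U) := by
    intro W hW W' hW' hne
    rw [Function.onFun, Finset.disjoint_left]
    intro π h1 h2
    obtain ⟨i, hi⟩ := mem_orderingsVia.1 h1
    obtain ⟨j, hj⟩ := mem_orderingsVia.1 h2
    rw [Finset.mem_coe, Finset.mem_powersetCard] at hW hW'
    refine hne ?_
    rw [← hi, ← hj]
    exact firstElems_inter_eq_of_card_eq π (by rw [hi, hj, hW.2, hW'.2])
  have huniv : (U.powersetCard D).biUnion (orderingsVia E U) = Finset.univ := by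
    refine Finset.eq_univ_of_forall fun π => ?_
    obtain ⟨j, hj⟩ := exists_card_firstElems_inter π hU hD
    exact Finset.mem_biUnion.2 ⟨firstElems π j ∩ U,
      Finset.mem_powersetCard.2 ⟨Finset.inter_subset_right, hj⟩, mem_orderingsVia.2 ⟨j, rfl⟩⟩
  have h1 : (B.biUnion (orderingsVia E U)).card = B.card * (orderingsVia E U W₀).card := by
    rw [Finset.card_biUnion (fun W hW W' hW' hne => hdisj (hB hW) (hB hW') hne),
      Finset.sum_congr rfl (fun W hW => hcard W (hB hW)), Finset.sum_const, smul_eq_mul]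
  have h2 : Fintype.card (Ordering E) = U.card.choose D * (orderingsVia E U W₀).card := by
    rw [← Finset.card_univ, ← huniv, Finset.card_biUnion hdisj,
      Finset.sum_congr rfl hcard, Finset.sum_const, smul_eq_mul, Finset.card_powersetCard]
  rw [h1, h2]; ring

/-! ### The first circuit of an ordering -/

theorem mem_breakPositions {M : Matroid α} {π : Ordering (ground M)} {t : Fin (ground M).card} :
    t ∈ breakPositions M π ↔
      M.Indep (firstElems π (t : ℕ)) ∧ ¬ M.Indep (firstElems π ((t : ℕ) + 1)) := by
  simp [breakPositions]

theorem exists_breakPosition {M : Matroid α} {π : Ordering (ground M)} {j : ℕ}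
    (hj : ¬ M.Indep (firstElems π j)) : ∃ t ∈ breakPositions M π, (t : ℕ) + 1 ≤ j := by
  classical
  have hex : ∃ j, ¬ M.Indep (firstElems π j) := ⟨j, hj⟩
  have hle := Nat.find_min' hex hj
  have hspec := Nat.find_spec hex
  rcases h : Nat.find hex with _ | i
  · rw [h, firstElems_zero] at hspec
    simp at hspec
  · have hi : M.Indep (firstElems π i) := not_not.1 (Nat.find_min hex (m := i) (by omega))
    rw [h] at hspec
    have hic : i < (ground M).card := by
      by_contra hc
      rw [firstElems_succ_of_card_le π (by omega)] at hspec
      exact hspec hi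
    exact ⟨⟨i, hic⟩, mem_breakPositions.2 ⟨hi, hspec⟩, by simp only; omega⟩

theorem findCircuit_subset {M : Matroid α} {π : Ordering (ground M)} {j : ℕ}
    (hj : ¬ M.Indep (firstElems π j)) {C : Finset α} (hC : findCircuit M π = some C) :
    C ⊆ firstElems π j := by
  classical
  obtain ⟨t, ht, htj⟩ := exists_breakPosition hj
  have hne : (breakPositions M π).Nonempty := ⟨t, ht⟩
  rw [findCircuit, dif_pos hne] at hC
  simp only [Option.some.injEq] at hC
  have hmin : (((breakPositions M π).min' hne : Fin _) : ℕ) ≤ t := Finset.min'_le _ _ ht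
  refine Finset.Subset.trans ?_ (firstElems_mono π (show
    (((breakPositions M π).min' hne : Fin _) : ℕ) + 1 ≤ j by omega))
  rw [← hC, firstElems_succ]
  exact Finset.insert_subset_insert _ (Finset.filter_subset _ _)

/-- `C` contains the fundamental circuit of the breaking element over the independent prefix before
it. Only this dependence is needed later, not that `C` is itself a circuit. -/
theorem not_indep_of_findCircuit {M : Matroid α} {π : Ordering (ground M)} {C : Finset α}
    (hC : findCircuit M π = some C) : ¬ M.Indep (C : Set α) := by
  classical
  rw [findCircuit] at hC
  split_ifs at hC with hne
  simp only [Option.some.injEq] at hC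
  obtain ⟨h1, h2⟩ := mem_breakPositions.1 (Finset.min'_mem _ hne)
  set t := (breakPositions M π).min' hne with ht
  have he : (π t : α) ∉ firstElems π t := notMem_firstElems π t
  rw [firstElems_succ, Finset.coe_insert] at h2
  have heE : (π t : α) ∈ M.E := mem_ground.1 (π t).2
  have hcl : (π t : α) ∈ M.closure (firstElems π t) := by
    rw [h1.mem_closure_iff']
    exact ⟨heE, fun h => absurd h h2⟩
  have hcirc := h1.fundCircuit_isCircuit hcl (by exact_mod_cast he)
  intro hind
  refine hcirc.not_indep (hind.subset ?_)
  intro y hy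
  rw [← hC, Finset.mem_coe, Finset.mem_insert, Finset.mem_filter]
  rcases M.fundCircuit_subset_insert _ _ hy with rfl | hy'
  · exact Or.inl rfl
  · right
    refine ⟨by exact_mod_cast hy', ?_⟩
    rw [h1.mem_fundCircuit_iff hcl (by exact_mod_cast he)] at hy
    convert hy using 1
    rw [Finset.coe_insert, Finset.coe_erase, Set.insert_sdiff_singleton_comm]
    rintro rfl
    exact he (by exact_mod_cast hy')

/-! ### The independence threshold `alpha` -/

section Alpha

variable (M : Matroid α) (S : Finset α)

open scoped Classical in
-- The family inside `indepProb` is elaborated as a `Finset (Set α)`; injectivity of the coercion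
-- turns it back into a family of finsets.
theorem indepProb_eq (l : ℕ) : indepProb M S l =
    (((S.powersetCard l).filter (fun T : Finset α => M.Indep (T : Set α))).card : ℝ) /
      S.card.choose l := by
  unfold indepProb
  rw [Finset.card_powersetCard]
  congr 2
  symm
  refine Finset.card_bij (fun T _ => (T : Set α)) ?_ (fun T _ T' _ h => Finset.coe_injective h) ?_
  · intro T hT
    simp only [Finset.mem_filter, Finset.bind_def, Finset.pure_def, Finset.sup_eq_biUnion,
      Finset.mem_biUnion, Finset.mem_singleton] at hT ⊢
    exact ⟨⟨T, hT.1, rfl⟩, hT.2⟩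
  · intro T hT
    simp only [Finset.mem_filter, Finset.bind_def, Finset.pure_def, Finset.sup_eq_biUnion,
      Finset.mem_biUnion, Finset.mem_singleton] at hT ⊢
    obtain ⟨⟨T', hT', rfl⟩, hi⟩ := hT
    exact ⟨T', ⟨hT', hi⟩, rfl⟩

theorem indepProb_nonneg (l : ℕ) : 0 ≤ indepProb M S l := by
  unfold indepProb; positivity

theorem indepProb_of_card_lt {l : ℕ} (h : S.card < l) : indepProb M S l = 0 := by
  rw [indepProb_eq, Nat.choose_eq_zero_of_lt h]; simp

open scoped Classical in
-- Double counting of pairs `T' ⊆ T`: all `l`-subsets of an independent set are independent, and an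
-- `l`-set has at most `|S| - l` extensions.
theorem card_indep_succ_mul_le (l : ℕ) :
    ((S.powersetCard (l + 1)).filter (fun T : Finset α => M.Indep (T : Set α))).card * (l + 1) ≤
      ((S.powersetCard l).filter (fun T : Finset α => M.Indep (T : Set α))).card * (S.card - l) := by
  refine Finset.card_mul_le_card_mul (fun T T' => T' ⊆ T) ?_ ?_
  · intro T hT
    simp only [Finset.mem_filter, Finset.mem_powersetCard] at hT
    obtain ⟨⟨hTS, hTc⟩, hTi⟩ := hT
    have : (T.powersetCard l).card = l + 1 := by
      rw [Finset.card_powersetCard, hTc, Nat.choose_succ_self_right]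
    rw [← this]
    refine Finset.card_le_card fun T' hT' => ?_
    rw [Finset.mem_powersetCard] at hT'
    simp only [Finset.mem_bipartiteAbove, Finset.mem_filter, Finset.mem_powersetCard]
    exact ⟨⟨⟨hT'.1.trans hTS, hT'.2⟩, hTi.subset (by exact_mod_cast hT'.1)⟩, hT'.1⟩
  · intro T' hT'
    simp only [Finset.mem_filter, Finset.mem_powersetCard] at hT'
    obtain ⟨⟨hTS, hTc⟩, hTi⟩ := hT'
    have : ((S \ T').image (fun x => insert x T')).card ≤ S.card - l := by
      refine Finset.card_image_le.trans ?_
      rw [Finset.card_sdiff_of_subset hTS, hTc]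
    refine le_trans (Finset.card_le_card fun T hT => ?_) this
    simp only [Finset.mem_bipartiteBelow, Finset.mem_filter, Finset.mem_powersetCard] at hT
    obtain ⟨⟨⟨h1, h2⟩, -⟩, h3⟩ := hT
    have hone : (T \ T').card = 1 := by
      rw [Finset.card_sdiff_of_subset h3, h2, hTc]; omega
    obtain ⟨x, hx⟩ := Finset.card_eq_one.1 hone
    have hxm : x ∈ T \ T' := by rw [hx]; simp
    rw [Finset.mem_sdiff] at hxm
    refine Finset.mem_image.2 ⟨x, Finset.mem_sdiff.2 ⟨h1 hxm.1, hxm.2⟩, ?_⟩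
    rw [← Finset.sdiff_union_of_subset h3, hx]
    rfl

theorem indepProb_antitone : Antitone (indepProb M S) := by
  classical
  refine antitone_nat_of_succ_le fun l => ?_
  by_cases hl : S.card < l + 1
  · rw [indepProb_of_card_lt M S hl]; exact indepProb_nonneg M S l
  have hl' : l + 1 ≤ S.card := by omega
  rw [indepProb_eq, indepProb_eq]
  have hc1 : (0 : ℝ) < S.card.choose (l + 1) := by exact_mod_cast Nat.choose_pos hl'
  have hc0 : (0 : ℝ) < S.card.choose l := by exact_mod_cast Nat.choose_pos (by omega)
  have hI : (((S.powersetCard (l + 1)).filter (fun T : Finset α => M.Indep (T : Set α))).card : ℝ) *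
      ((l + 1 : ℕ) : ℝ) ≤
      (((S.powersetCard l).filter (fun T : Finset α => M.Indep (T : Set α))).card : ℝ) *
      ((S.card - l : ℕ) : ℝ) := by exact_mod_cast card_indep_succ_mul_le M S l
  have hC : (S.card.choose (l + 1) : ℝ) * ((l + 1 : ℕ) : ℝ) =
      S.card.choose l * ((S.card - l : ℕ) : ℝ) := by
    exact_mod_cast Nat.choose_succ_right_eq S.card l
  have hd : (0 : ℝ) < ((l + 1 : ℕ) : ℝ) := by positivity
  have he : (0 : ℝ) < ((S.card - l : ℕ) : ℝ) := by exact_mod_cast (by omega : 0 < S.card - l)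
  rw [div_le_div_iff₀ hc1 hc0]
  refine le_of_mul_le_mul_right ?_ (mul_pos hd he)
  calc _ = ((((S.powersetCard (l + 1)).filter (fun T : Finset α => M.Indep (T : Set α))).card : ℝ) *
        ((l + 1 : ℕ) : ℝ)) * (S.card.choose l * ((S.card - l : ℕ) : ℝ)) := by ring
    _ ≤ ((((S.powersetCard l).filter (fun T : Finset α => M.Indep (T : Set α))).card : ℝ) *
        ((S.card - l : ℕ) : ℝ)) * (S.card.choose l * ((S.card - l : ℕ) : ℝ)) := by gcongr
    _ = _ := by rw [← hC]; ring

theorem half_lt_indepProb {l : ℕ} (h : l < alpha M S) : 1 / 2 < indepProb M S l := by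
  have := Nat.notMem_of_lt_sInf h
  simpa using this

theorem indepProb_le_half {l : ℕ} (h : alpha M S ≤ l) : indepProb M S l ≤ 1 / 2 := by
  refine (indepProb_antitone M S h).trans ?_
  have : alpha M S ∈ {l : ℕ | indepProb M S l ≤ 1 / 2} :=
    Nat.sInf_mem ⟨S.card + 1, by
      rw [Set.mem_ofPred_eq, indepProb_of_card_lt M S (by omega)]; norm_num⟩
  exact this

open scoped Classical in
theorem half_choose_le_card_indep {l : ℕ} (h : l < alpha M S) :
    (S.card.choose l : ℝ) ≤
      2 * ((S.powersetCard l).filter (fun T : Finset α => M.Indep (T : Set α))).card := by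
  have h1 := half_lt_indepProb M S h
  rw [indepProb_eq] at h1
  rcases Nat.eq_zero_or_pos (S.card.choose l) with h0 | h0
  · rw [h0]; simp
  · have hc0 : (0 : ℝ) < S.card.choose l := by exact_mod_cast h0
    rw [lt_div_iff₀ hc0] at h1
    linarith

open scoped Classical in
theorem half_choose_le_card_dep {l : ℕ} (h : alpha M S ≤ l) :
    (S.card.choose l : ℝ) ≤
      2 * ((S.powersetCard l).filter (fun T : Finset α => ¬ M.Indep (T : Set α))).card := by
  have h1 := indepProb_le_half M S h
  rw [indepProb_eq] at h1
  have h2 := Finset.card_filter_add_card_filter_not (s := S.powersetCard l)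
    (fun T : Finset α => M.Indep (T : Set α))
  rw [Finset.card_powersetCard] at h2
  rcases Nat.eq_zero_or_pos (S.card.choose l) with h0 | h0
  · rw [h0]; simp
  · have hc0 : (0 : ℝ) < S.card.choose l := by exact_mod_cast h0
    rw [div_le_iff₀ hc0] at h1
    have h2' : (((S.powersetCard l).filter (fun T : Finset α => M.Indep (T : Set α))).card : ℝ) +
      ((S.powersetCard l).filter (fun T : Finset α => ¬ M.Indep (T : Set α))).card = S.card.choose l := by
      exact_mod_cast h2
    linarith

theorem alpha_congr {M M' : Matroid α} {S : Finset α}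
    (h : ∀ T ⊆ S, (M.Indep (T : Set α) ↔ M'.Indep (T : Set α))) : alpha M S = alpha M' S := by
  classical
  have : indepProb M S = indepProb M' S := by
    funext l
    rw [indepProb_eq, indepProb_eq]
    congr 3
    exact Finset.filter_congr fun T hT => h T (Finset.mem_powersetCard.1 hT).1
  unfold alpha
  rw [this]

theorem lt_alpha {l : ℕ} (hl : l ≤ S.card)
    (h : ∀ T ⊆ S, T.card ≤ l → M.Indep (T : Set α)) : l < alpha M S := by
  classical
  by_contra hc
  have h1 := indepProb_le_half M S (not_lt.1 hc)
  rw [indepProb_eq] at h1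
  rw [Finset.filter_true_of_mem (fun T hT => by
    rw [Finset.mem_powersetCard] at hT
    exact h T hT.1 hT.2.le)] at h1
  have hpos : (0 : ℝ) < S.card.choose l := by exact_mod_cast Nat.choose_pos hl
  rw [Finset.card_powersetCard, div_self hpos.ne'] at h1
  norm_num at h1

end Alpha

/-! ### Sets capturing the first circuit -/

open scoped Classical in
/-- The orderings whose first circuit does not exist or is not contained in `S`. -/
noncomputable def escaping (M : Matroid α) (S : Finset α) : Finset (Ordering (ground M)) :=
  Finset.univ.filter (fun π => ¬ ∃ C, findCircuit M π = some C ∧ C ⊆ S)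

/-- The first circuit of a random ordering is contained in `S` with probability at least
`1 - 2⁻¹⁸`. -/
def Captures (M : Matroid α) (S : Finset α) : Prop :=
  2 ^ 18 * (escaping M S).card ≤ Fintype.card (Ordering (ground M))

theorem Captures.exists_dep_subset {M : Matroid α} {S : Finset α} (h : Captures M S) :
    ∃ C ⊆ S, ¬ M.Indep (C : Set α) := by
  by_contra! hc
  have : escaping M S = Finset.univ := by
    refine Finset.eq_univ_of_forall fun π => ?_
    simp only [escaping, Finset.mem_filter, Finset.mem_univ, true_and]
    rintro ⟨C, hC, hCS⟩
    exact not_indep_of_findCircuit hC (hc C hCS)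
  rw [Captures, this, Finset.card_univ] at h
  have := Fintype.card_pos (α := Ordering (ground M))
  omega

/-- The prefix meeting `S ∪ T` in `W` is dependent, so it contains the first circuit; lying in `S`,
that circuit would lie in the independent set `W ∩ S`. -/
theorem orderingsVia_subset_escaping {M : Matroid α} {S T W : Finset α}
    (hS : M.Indep (W ∩ S : Finset α)) (hT : ¬ M.Indep (W ∩ T : Finset α)) :
    orderingsVia (ground M) (S ∪ T) W ⊆ escaping M S := by
  intro π hπ
  obtain ⟨j, hj⟩ := mem_orderingsVia.1 hπ
  simp only [escaping, Finset.mem_filter, Finset.mem_univ, true_and]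
  rintro ⟨C, hC, hCS⟩
  have hWj : W ⊆ firstElems π j := by rw [← hj]; exact Finset.inter_subset_left
  have hdep : ¬ M.Indep (firstElems π j : Set α) := fun hi =>
    hT (hi.subset (by exact_mod_cast Finset.inter_subset_left.trans hWj))
  have hCj := findCircuit_subset hdep hC
  refine not_indep_of_findCircuit hC (hS.subset ?_)
  have : C ⊆ W ∩ S := by
    rw [← hj]
    intro x hx
    simp only [Finset.mem_inter, Finset.mem_union]
    exact ⟨⟨hCj hx, Or.inl (hCS hx)⟩, hCS hx⟩
  exact_mod_cast this

open scoped Classical in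
-- For `h ≥ α(T)`, at least half of the `h`-subsets of `T` are dependent, and at least half of the
-- complementary-size subsets of `S` are independent, since that size is below `α(S)`. Hence the
-- factor `4`.
theorem sum_choose_le_card_split (M : Matroid α) {S T : Finset α} (hST : Disjoint S T)
    (hb : 1 ≤ alpha M T) :
    ∑ h ∈ Finset.Ico (alpha M T) (alpha M S + alpha M T),
        (T.card.choose h : ℝ) * S.card.choose (alpha M S + alpha M T - 1 - h) ≤
      4 * (((S ∪ T).powersetCard (alpha M S + alpha M T - 1)).filter
        (fun W => M.Indep (W ∩ S : Finset α) ∧ ¬ M.Indep (W ∩ T : Finset α))).card := by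
  set a := alpha M S with ha
  set b := alpha M T with hb'
  let I : ℕ → Finset (Finset α) := fun l =>
    (S.powersetCard l).filter (fun X : Finset α => M.Indep (X : Set α))
  let J : ℕ → Finset (Finset α) := fun l =>
    (T.powersetCard l).filter (fun X : Finset α => ¬ M.Indep (X : Set α))
  have hinj : ∑ h ∈ Finset.Ico b (a + b), (J h).card * (I (a + b - 1 - h)).card ≤
      (((S ∪ T).powersetCard (a + b - 1)).filter
        (fun W => M.Indep (W ∩ S : Finset α) ∧ ¬ M.Indep (W ∩ T : Finset α))).card := by
    simp_rw [← Finset.card_product]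
    rw [← Finset.card_sigma]
    have key : ∀ X Y : Finset α, X ⊆ T → Y ⊆ S → (X ∪ Y) ∩ T = X ∧ (X ∪ Y) ∩ S = Y := by
      intro X Y hX hY
      rw [Finset.disjoint_left] at hST
      constructor <;> ext x <;> have := @hX x <;> have := @hY x <;> have := @hST x <;>
        simp only [Finset.mem_inter, Finset.mem_union] <;> tauto
    refine Finset.card_le_card_of_injOn (fun z => z.2.1 ∪ z.2.2) ?_ ?_
    · rintro ⟨h, X, Y⟩ hz
      simp only [Finset.mem_coe, Finset.mem_sigma, Finset.mem_Ico, Finset.mem_product, I, J,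
        Finset.mem_filter, Finset.mem_powersetCard] at hz ⊢
      obtain ⟨hh, ⟨⟨hXT, hXc⟩, hXd⟩, ⟨hYS, hYc⟩, hYi⟩ := hz
      obtain ⟨k1, k2⟩ := key X Y hXT hYS
      refine ⟨⟨?_, ?_⟩, ?_, ?_⟩
      · exact Finset.union_subset (hXT.trans Finset.subset_union_right)
          (hYS.trans Finset.subset_union_left)
      · rw [Finset.card_union_of_disjoint (Finset.disjoint_of_subset_left hXT
          (Finset.disjoint_of_subset_right hYS hST.symm)), hXc, hYc]
        omega
      · rwa [k2]
      · rwa [k1]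
    · rintro ⟨h, X, Y⟩ hz ⟨h', X', Y'⟩ hz' he
      simp only [Finset.mem_coe, Finset.mem_sigma, Finset.mem_Ico, Finset.mem_product, I, J,
        Finset.mem_filter, Finset.mem_powersetCard] at hz hz' he
      obtain ⟨-, ⟨⟨hXT, hXc⟩, -⟩, ⟨hYS, -⟩, -⟩ := hz
      obtain ⟨-, ⟨⟨hXT', hXc'⟩, -⟩, ⟨hYS', -⟩, -⟩ := hz'
      obtain ⟨k1, k2⟩ := key X Y hXT hYS
      obtain ⟨k1', k2'⟩ := key X' Y' hXT' hYS'
      have eX : X = X' := by rw [← k1, ← k1', he]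
      have eY : Y = Y' := by rw [← k2, ← k2', he]
      have eh : h = h' := by rw [← hXc, ← hXc', eX]
      subst eX eY eh
      rfl
  have hterm : ∀ h ∈ Finset.Ico b (a + b),
      (T.card.choose h : ℝ) * S.card.choose (a + b - 1 - h) ≤
        4 * (((J h).card * (I (a + b - 1 - h)).card : ℕ) : ℝ) := by
    intro h hh
    rw [Finset.mem_Ico] at hh
    have h1 := half_choose_le_card_dep M T hh.1
    have h2 := half_choose_le_card_indep M S (l := a + b - 1 - h) (by omega)
    push_cast
    calc _ ≤ (2 * ((J h).card : ℝ)) * (2 * ((I (a + b - 1 - h)).card : ℝ)) := by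
          gcongr
      _ = _ := by ring
  refine (Finset.sum_le_sum hterm).trans ?_
  rw [← Finset.mul_sum, ← Nat.cast_sum]
  gcongr

/-- If `S` captures the first circuit and `T` is disjoint from `S` and not much smaller, then
`alpha M T` exceeds the proportional share of `alpha M S`. -/
theorem alpha_growth_of_captures {M : Matroid α} {S T : Finset α} (hS : S ⊆ ground M)
    (hT : T ⊆ ground M) (hST : Disjoint S T) (hcap : Captures M S)
    (ha : 51 ≤ alpha M S) (hb : 1 ≤ alpha M T) (has : 9 * alpha M S ≤ S.card)
    (hbt : 9 * alpha M T ≤ T.card) (hst : S.card ≤ 2 * T.card) :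
    (alpha M S : ℝ) * T.card / S.card
      + 1 / (5 * √2) * √((alpha M S : ℝ) * T.card / S.card) ≤ (alpha M T : ℝ) := by
  classical
  by_contra! hlt
  have h1 := hypergeometric_upper_tail ha hb has hbt hst hlt.le
  have h2 := sum_choose_le_card_split M hST hb
  set D := alpha M S + alpha M T - 1 with hD
  set B := ((S ∪ T).powersetCard D).filter
        (fun W => M.Indep (W ∩ S : Finset α) ∧ ¬ M.Indep (W ∩ T : Finset α)) with hB
  have hcard : (S ∪ T).card = S.card + T.card := Finset.card_union_of_disjoint hST
  have hDle : D ≤ (S ∪ T).card := by omega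
  have h3 := card_biUnion_orderingsVia (Finset.union_subset hS hT) hDle
    (B := B) (Finset.filter_subset _ _)
  have h4 : (B.biUnion (orderingsVia (ground M) (S ∪ T))).card ≤ (escaping M S).card := by
    refine Finset.card_le_card (Finset.biUnion_subset.2 fun W hW => ?_)
    rw [hB, Finset.mem_filter] at hW
    exact orderingsVia_subset_escaping hW.2.1 hW.2.2
  rw [hcard] at h3 hDle
  have hC : 0 < (S.card + T.card).choose D := Nat.choose_pos hDle
  have hO : 0 < Fintype.card (Ordering (ground M)) := Fintype.card_pos
  have h5 : 2 ^ 18 * B.card ≤ (S.card + T.card).choose D := by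
    refine Nat.le_of_mul_le_mul_right ?_ hO
    calc 2 ^ 18 * B.card * Fintype.card (Ordering (ground M))
        = (2 ^ 18 * (B.biUnion (orderingsVia (ground M) (S ∪ T))).card) *
            (S.card + T.card).choose D := by rw [mul_assoc, ← h3]; ring
      _ ≤ Fintype.card (Ordering (ground M)) * (S.card + T.card).choose D := by
          refine Nat.mul_le_mul_right _ (le_trans ?_ hcap)
          exact Nat.mul_le_mul_left _ h4
      _ = _ := mul_comm _ _
  have h5' : (2 : ℝ) ^ 18 * B.card ≤ (S.card + T.card).choose D := by exact_mod_cast h5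
  have hC' : (0 : ℝ) < (S.card + T.card).choose D := by exact_mod_cast hC
  linarith

/-! ### Concentration of the estimates -/

theorem two_le_one_add_inv_pow : (2 : ℝ) ≤ (1 + 1 / 2 ^ 20) ^ 2 ^ 20 := by
  have e : ((2 ^ 20 : ℕ) : ℝ) * (1 / 2 ^ 20) = 1 := by norm_num
  calc (2 : ℝ) = 1 + ((2 ^ 20 : ℕ) : ℝ) * (1 / 2 ^ 20) := by rw [e]; norm_num
    _ ≤ _ := one_add_mul_le_pow (by norm_num) (2 ^ 20)

open scoped Classical in
/-- The samples `ω` of size `N` with at most `N / 2 ^ 20` hits in `F`. -/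
noncomputable def fewHits {Ω : Type*} [Fintype Ω] (F : Finset Ω) (N : ℕ) : Finset (Fin N → Ω) :=
  Finset.univ.filter (fun ω => 2 ^ 20 * (Finset.univ.filter (fun i => ω i ∈ F)).card ≤ N)

/-- Chernoff's method with weight `2^(-hits)`: writing `u = 2⁻²⁰`, few hits make the weight at least
`(1 + u)^(-N)`, its mean is at most `(1 - 2u)^N`, and `(1 + u)(1 - 2u) ≤ 1 - u`. -/
theorem card_fewHits_le {Ω : Type*} [Fintype Ω] (F : Finset Ω)
    (hF : Fintype.card Ω < 2 ^ 18 * F.card) (N : ℕ) :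
    ((fewHits F N).card : ℝ) ≤
      (1 - 1 / 2 ^ 20) ^ N * (Fintype.card Ω : ℝ) ^ N := by
  classical
  set u : ℝ := 1 / 2 ^ 20 with hu
  let g : Ω → ℝ := fun x => if x ∈ F then 1 / 2 else 1
  have hg : ∀ ω : Fin N → Ω,
      ∏ i, g (ω i) = (1 / 2 : ℝ) ^ (Finset.univ.filter (fun i => ω i ∈ F)).card := by
    intro ω
    simp only [g]
    rw [Finset.prod_ite, Finset.prod_const, Finset.prod_const_one, mul_one]
  have hc : (2 : ℝ) ≤ (1 + u) ^ 2 ^ 20 := two_le_one_add_inv_pow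
  have h1 : ∀ ω ∈ fewHits F N,
      (1 : ℝ) ≤ (1 + u) ^ N * ∏ i, g (ω i) := by
    intro ω hω
    have hω' : 2 ^ 20 * (Finset.univ.filter (fun i => ω i ∈ F)).card ≤ N := by
      convert (Finset.mem_filter.1 hω).2
    rw [hg]
    set m := (Finset.univ.filter (fun i => ω i ∈ F)).card
    have hm : (2 : ℝ) ^ m ≤ (1 + u) ^ N := by
      calc (2 : ℝ) ^ m ≤ ((1 + u) ^ 2 ^ 20) ^ m := by gcongr
        _ = (1 + u) ^ (2 ^ 20 * m) := by rw [pow_mul]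
        _ ≤ (1 + u) ^ N := by
            refine pow_le_pow_right₀ ?_ hω'
            rw [hu]; norm_num
    calc (1 : ℝ) = 2 ^ m * (1 / 2) ^ m := by rw [← mul_pow]; norm_num
      _ ≤ _ := by gcongr
  have hsum : ∑ x, g x = Fintype.card Ω - (F.card : ℝ) / 2 := by
    have : ∀ x, g x = 1 - (if x ∈ F then 1 / 2 else 0) := by
      intro x; simp only [g]; split_ifs <;> norm_num
    simp_rw [this]
    rw [Finset.sum_sub_distrib, Finset.sum_ite_mem]
    simp; ring
  have hg0 : 0 ≤ ∑ x, g x := Finset.sum_nonneg fun x _ => by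
    simp only [g]; split_ifs <;> norm_num
  have hF' : (Fintype.card Ω : ℝ) ≤ 2 ^ 18 * F.card := by exact_mod_cast hF.le
  calc _ = ∑ ω ∈ fewHits F N, (1 : ℝ) := by simp
    _ ≤ ∑ ω ∈ fewHits F N,
          (1 + u) ^ N * ∏ i, g (ω i) := Finset.sum_le_sum h1
    _ ≤ ∑ ω : Fin N → Ω, (1 + u) ^ N * ∏ i, g (ω i) := by
        refine Finset.sum_le_sum_of_subset_of_nonneg (Finset.subset_univ _) fun ω _ _ => ?_
        rw [hg]; positivity
    _ = ((1 + u) * ∑ x, g x) ^ N := by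
        rw [← Finset.mul_sum, mul_pow, Finset.sum_pow' Finset.univ g N, Fintype.piFinset_univ]
    _ ≤ ((1 - u) * Fintype.card Ω) ^ N := by
        refine pow_le_pow_left₀ (by positivity) ?_ N
        rw [hsum]
        have hΩ : (0 : ℝ) ≤ Fintype.card Ω := by positivity
        rw [hu]
        nlinarith
    _ = _ := mul_pow _ _ _

theorem threshold_ge (n m : ℕ) : 1 - 1 / 2 ^ 20 ≤ threshold n m := by
  have h1 : 0 ≤ Real.logb 2 n := by
    rcases Nat.eq_zero_or_pos n with rfl | hn
    · simp
    · exact Real.logb_nonneg (by norm_num) (by exact_mod_cast hn)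
  have h2 : 0 ≤ ∑ i ∈ Finset.Icc 1 m, 1 / (i : ℝ) := Finset.sum_nonneg fun i _ => by positivity
  unfold threshold
  have : 0 ≤ (∑ i ∈ Finset.Icc 1 m, 1 / (i : ℝ)) / (2 ^ 20 * Real.logb 2 n) := by positivity
  linarith

theorem shrink_spec (n : ℕ) (q : Finset α → ℝ) (S : Finset α) :
    shrink n q S ⊆ S ∧ (shrink n q S = S ∨ 1 - 1 / 2 ^ 20 ≤ q (shrink n q S)) := by
  classical
  induction hk : S.card using Nat.strong_induction_on generalizing S with
  | _ k ih =>
    rw [shrink]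
    split_ifs with h
    · have hmem := Finset.mem_filter.1 (Finset.min'_mem _ h)
      set x := (S.filter (fun x => threshold n (S.card - 1) ≤ q (S.erase x))).min' h
      obtain ⟨h1, h2⟩ := ih (S.erase x).card (hk ▸ Finset.card_erase_lt_of_mem hmem.1) _ rfl
      refine ⟨h1.trans (Finset.erase_subset _ _), Or.inr ?_⟩
      rcases h2 with h2 | h2
      · rw [h2]; exact (threshold_ge _ _).trans hmem.2
      · exact h2
    · exact ⟨Finset.Subset.rfl, Or.inl rfl⟩

theorem mem_fewHits_of_le_estQ {M : Matroid α} {N : ℕ} (hN : 0 < N)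
    {ω : Fin N → Ordering (ground M)} {S : Finset α} (h : 1 - 1 / 2 ^ 20 ≤ estQ M ω S) :
    ω ∈ fewHits (escaping M S) N := by
  classical
  refine Finset.mem_filter.2 ⟨Finset.mem_univ _, ?_⟩
  unfold estQ at h
  have hN' : (0 : ℝ) < N := by exact_mod_cast hN
  rw [le_div_iff₀ hN'] at h
  have h2 := Finset.card_filter_add_card_filter_not (s := (Finset.univ : Finset (Fin N)))
    (fun i => ∃ C, findCircuit M (ω i) = some C ∧ C ⊆ S)
  have h3 : ∀ i, ω i ∈ escaping M S ↔ ¬ ∃ C, findCircuit M (ω i) = some C ∧ C ⊆ S := by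
    simp only [escaping, Finset.mem_filter, Finset.mem_univ, true_and, implies_true]
  simp only [h3]
  rw [Finset.card_univ, Fintype.card_fin] at h2
  have h2' : ((Finset.univ.filter
      (fun i => ∃ C, findCircuit M (ω i) = some C ∧ C ⊆ S)).card : ℝ) + (Finset.univ.filter
      (fun i => ¬ ∃ C, findCircuit M (ω i) = some C ∧ C ⊆ S)).card = N := by exact_mod_cast h2
  have : (2 : ℝ) ^ 20 * (Finset.univ.filter
      (fun i => ¬ ∃ C, findCircuit M (ω i) = some C ∧ C ⊆ S)).card ≤ N := by
    linarith
  exact_mod_cast this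

/-- The factor `2 ^ n₀` pays for the union bound over subsets. As `8 ^ 9 = 2 ^ 27`, the exponent `n₀
^ 10` exceeds `2 ^ 20 * 3 n₀`, and each `2 ^ 20` factors at least halve the product. -/
theorem two_pow_mul_pow_le {n₀ : ℕ} (hn : 8 ≤ n₀) :
    (2 : ℝ) ^ n₀ * (1 - 1 / 2 ^ 20) ^ (n₀ ^ 10) ≤ (1 / 2) ^ (2 * n₀) := by
  set u : ℝ := 1 / 2 ^ 20 with hu
  have hc : (2 : ℝ) ≤ (1 + u) ^ 2 ^ 20 := two_le_one_add_inv_pow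
  have hu0 : 0 ≤ 1 - u := by rw [hu]; norm_num
  have hu1 : 1 - u ≤ 1 := by rw [hu]; norm_num
  have hd : (1 - u) ^ 2 ^ 20 ≤ 1 / 2 := by
    have h1 : (1 - u) ^ 2 ^ 20 * (1 + u) ^ 2 ^ 20 ≤ 1 := by
      rw [← mul_pow]
      exact pow_le_one₀ (mul_nonneg hu0 (by rw [hu]; norm_num)) (by rw [hu]; norm_num)
    have h2 : 0 ≤ (1 - u) ^ 2 ^ 20 := pow_nonneg hu0 _
    have h3 := mul_le_mul_of_nonneg_left hc h2
    rw [le_div_iff₀ (by norm_num)]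
    exact h3.trans h1
  have hexp : 2 ^ 20 * (3 * n₀) ≤ n₀ ^ 10 := by
    have : 8 ^ 9 ≤ n₀ ^ 9 := Nat.pow_le_pow_left hn 9
    calc 2 ^ 20 * (3 * n₀) ≤ 8 ^ 9 * n₀ := by norm_num; omega
      _ ≤ n₀ ^ 9 * n₀ := Nat.mul_le_mul_right _ this
      _ = n₀ ^ 10 := by ring
  calc (2 : ℝ) ^ n₀ * (1 - u) ^ (n₀ ^ 10) ≤ 2 ^ n₀ * (1 - u) ^ (2 ^ 20 * (3 * n₀)) := by
        refine mul_le_mul_of_nonneg_left ?_ (by positivity)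
        exact pow_le_pow_of_le_one hu0 hu1 hexp
    _ = 2 ^ n₀ * ((1 - u) ^ 2 ^ 20) ^ (3 * n₀) := by rw [pow_mul (1 - u) (2 ^ 20)]
    _ ≤ 2 ^ n₀ * (1 / 2) ^ (3 * n₀) := by
        refine mul_le_mul_of_nonneg_left ?_ (by positivity)
        exact pow_le_pow_left₀ (pow_nonneg hu0 _) hd _
    _ = (1 / 2) ^ (2 * n₀) := by
        rw [show 3 * n₀ = n₀ + 2 * n₀ by ring, pow_add, ← mul_assoc, ← mul_pow]
        norm_num

/-- Shrinking with respect to the estimates from `N` samples gives the whole ground set or a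
capturing set, up to a small probability of failure. -/
theorem shrink_failure {n₀ N : ℕ} (hN0 : 0 < N)
    (hpow : (2 : ℝ) ^ n₀ * (1 - 1 / 2 ^ 20) ^ N ≤ (1 / 2) ^ (2 * n₀)) (M : Matroid α)
    (hM : (ground M).card ≤ n₀) :
    ((PMF.uniformOfFintype (Fin N → Ordering (ground M))).map
      (fun ω => shrink (ground M).card (estQ M ω) (ground M))).toOuterMeasure
      {S | ¬ (S ⊆ ground M ∧ (S = ground M ∨ Captures M S))} ≤ (1 / 2 : ℝ≥0∞) ^ (2 * n₀) := by
  classical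
  rw [PMF.toOuterMeasure_map_apply, PMF.toOuterMeasure_uniformOfFintype_apply]
  set Ω := Ordering (ground M)
  let bad : Finset α → Finset (Fin N → Ω) := fun S => fewHits (escaping M S) N
  -- The returned set depends on the same samples as its estimate, so all non-capturing subsets are
  -- excluded simultaneously.
  let I := (ground M).powerset.filter (fun S => ¬ Captures M S)
  have hsub : ((fun ω : Fin N → Ω => shrink (ground M).card (estQ M ω) (ground M)) ⁻¹'
      {S | ¬ (S ⊆ ground M ∧ (S = ground M ∨ Captures M S))}) ⊆ (I.biUnion bad : Set _) := by
    intro ω hω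
    simp only [Set.mem_preimage, Set.mem_ofPred_eq] at hω
    obtain ⟨h1, h2⟩ := shrink_spec (ground M).card (estQ M ω) (ground M)
    set S := shrink (ground M).card (estQ M ω) (ground M)
    have h3 : S ≠ ground M ∧ ¬ Captures M S := by tauto
    have h4 := h2.resolve_left h3.1
    simp only [Finset.coe_biUnion, Set.mem_iUnion]
    refine ⟨S, Finset.mem_coe.2 (Finset.mem_filter.2 ⟨Finset.mem_powerset.2 h1, h3.2⟩), ?_⟩
    exact Finset.mem_coe.2 (mem_fewHits_of_le_estQ hN0 h4)
  have hcard : ((I.biUnion bad).card : ℝ) ≤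
      (1 / 2) ^ (2 * n₀) * (Fintype.card (Fin N → Ω) : ℝ) := by
    have h1 : ∀ S ∈ I, ((bad S).card : ℝ) ≤
        (1 - 1 / 2 ^ 20) ^ N * (Fintype.card Ω : ℝ) ^ N := by
      intro S hS
      have h2 : ¬ Captures M S := (Finset.mem_filter.1 hS).2
      unfold Captures at h2
      exact card_fewHits_le _ (not_le.1 h2) N
    have hu0 : (0 : ℝ) ≤ 1 - 1 / 2 ^ 20 := by norm_num
    have hI : I.card ≤ 2 ^ n₀ := by
      refine (Finset.card_filter_le _ _).trans ?_
      rw [Finset.card_powerset]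
      exact Nat.pow_le_pow_right (by norm_num) hM
    have hI' : (I.card : ℝ) ≤ 2 ^ n₀ := by exact_mod_cast hI
    have h0 : ((I.biUnion bad).card : ℝ) ≤ ∑ S ∈ I, ((bad S).card : ℝ) := by
      rw [← Nat.cast_sum]
      exact Nat.cast_le.2 Finset.card_biUnion_le
    generalize (1 - 1 / 2 ^ 20 : ℝ) = v at h1 hu0 hpow
    refine h0.trans ((Finset.sum_le_sum h1).trans ?_)
    rw [Finset.sum_const, nsmul_eq_mul, Fintype.card_fun, Fintype.card_fin, Nat.cast_pow,
      ← mul_assoc]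
    refine mul_le_mul_of_nonneg_right (le_trans ?_ hpow) (by positivity)
    exact mul_le_mul_of_nonneg_right hI' (pow_nonneg hu0 _)
  have hΩ0 : (Fintype.card (Fin N → Ω) : ℝ≥0∞) ≠ 0 := by
    exact_mod_cast (Fintype.card_pos (α := Fin N → Ω)).ne'
  rw [ENNReal.div_le_iff hΩ0 (ENNReal.natCast_ne_top _)]
  have hle := Set.card_le_card hsub
  rw [← Set.toFinset_card (I.biUnion bad : Set (Fin N → Ω)), Finset.toFinset_coe] at hle
  refine le_trans (by exact_mod_cast hle :
    _ ≤ (((I.biUnion bad).card : ℕ) : ℝ≥0∞)) ?_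
  have h5 := ENNReal.ofReal_le_ofReal hcard
  rw [ENNReal.ofReal_mul (by positivity), ENNReal.ofReal_natCast, ENNReal.ofReal_natCast,
    ENNReal.ofReal_pow (by norm_num), ENNReal.ofReal_div_of_pos (by norm_num),
    ENNReal.ofReal_one, ENNReal.ofReal_ofNat] at h5
  exact h5

/-- `FindGreedilyOptimal` returns the whole ground set or a capturing set, up to a small
probability of failure. -/
theorem findGreedilyOptimal_failure {n₀ : ℕ} (hn₀ : 8 ≤ n₀) (M : Matroid α)
    (hM : (ground M).card ≤ n₀) :
    (findGreedilyOptimal n₀ M).toOuterMeasure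
      {S | ¬ (S ⊆ ground M ∧ (S = ground M ∨ Captures M S))} ≤ (1 / 2 : ℝ≥0∞) ^ (2 * n₀) :=
  shrink_failure (by positivity) (two_pow_mul_pow_le hn₀) M hM

/-! ### Good runs -/

/-- A list that `IterativePeel` may return on `M` when every set that it peels off captures the
first circuit. -/
def GoodRun : Matroid α → List (Finset α) → Prop
  | _, [] => True
  | M, S :: L => S ⊆ ground M ∧ Captures M S ∧
      (alpha M S : ℝ) / (S.card : ℝ) < 1 / Real.logb 2 ((ground M).card : ℝ) ∧
      (S.card : ℝ) ≤ ((ground M).card : ℝ) / 2 ∧ GoodRun (M.delete (S : Set α)) L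

theorem ground_mono {M M' : Matroid α} (h : M'.E ⊆ M.E) : ground M' ⊆ ground M :=
  fun _ hx => mem_ground.2 (h (mem_ground.1 hx))

/-- Each iteration contributes its own failure probability. Stopping, for whatever reason, is
harmless because the empty list is a good run. -/
theorem peelLoop_failure {n₀ : ℕ} (hn₀ : 8 ≤ n₀) (fuel : ℕ) (M : Matroid α)
    (hM : (ground M).card ≤ n₀) :
    (peelLoop n₀ fuel M).toOuterMeasure {L | ¬ GoodRun M L} ≤
      fuel * (1 / 2 : ℝ≥0∞) ^ (2 * n₀) := by
  classical
  induction fuel generalizing M with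
  | zero => simp [peelLoop, PMF.toOuterMeasure_pure_apply, GoodRun]
  | succ fuel ih =>
    set ε := (1 / 2 : ℝ≥0∞) ^ (2 * n₀) with hε
    rw [peelLoop]
    split_ifs with hE
    · simp [PMF.toOuterMeasure_pure_apply, GoodRun]
    rw [PMF.toOuterMeasure_bind_apply]
    set B : Set (Finset α) := {S | ¬ (S ⊆ ground M ∧ (S = ground M ∨ Captures M S))} with hB
    have hE0 : (0 : ℝ) < (ground M).card := by
      have : (ground M).Nonempty := by
        rw [← Finset.coe_nonempty, coe_ground]
        exact Set.nonempty_iff_ne_empty.2 hE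
      exact_mod_cast this.card_pos
    have hstep : ∀ S, (if 1 / Real.logb 2 ((ground M).card : ℝ) ≤ (alpha M S : ℝ) / (S.card : ℝ) ∨
          ((ground M).card : ℝ) / 2 < (S.card : ℝ) then PMF.pure []
      else (peelLoop n₀ fuel (M.delete (S : Set α))).map (fun L => S :: L)).toOuterMeasure
        {L | ¬ GoodRun M L} ≤ fuel * ε + B.indicator 1 S := by
      intro S
      by_cases hS : S ∈ B
      · rw [Set.indicator_of_mem hS]
        refine le_trans ?_ le_add_self
        refine (MeasureTheory.measure_mono (Set.subset_univ _)).trans ?_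
        exact ((PMF.toOuterMeasure_apply_eq_one_iff _ _).2 (Set.subset_univ _)).le
      · rw [Set.indicator_of_notMem hS, add_zero]
        rw [hB, Set.mem_ofPred_eq, not_not] at hS
        split_ifs with hc
        · simp [PMF.toOuterMeasure_pure_apply, GoodRun]
        · push Not at hc
          -- The whole ground set would have triggered the stopping rule `|S| > |E| / 2`.
          have hne : S ≠ ground M := by
            rintro rfl
            linarith [hc.2]
          rw [PMF.toOuterMeasure_map_apply]
          refine le_trans (MeasureTheory.measure_mono ?_)
            (ih (M.delete (S : Set α)) ((Finset.card_le_card (ground_mono (by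
              rw [Matroid.delete_ground]; exact Set.sdiff_subset))).trans hM))
          intro L hL hgood
          exact hL ⟨hS.1, hS.2.resolve_left hne, hc.1, hc.2, hgood⟩
    calc _ ≤ ∑' S, findGreedilyOptimal n₀ M S * (fuel * ε + B.indicator 1 S) :=
          ENNReal.tsum_le_tsum fun S => by gcongr; exact hstep S
      _ = (∑' S, findGreedilyOptimal n₀ M S * (fuel * ε)) +
            ∑' S, B.indicator (findGreedilyOptimal n₀ M) S := by
          rw [← ENNReal.tsum_add]
          refine tsum_congr fun S => ?_
          rw [mul_add]
          congr 1
          by_cases hS : S ∈ B <;> simp [hS]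
      _ = fuel * ε + (findGreedilyOptimal n₀ M).toOuterMeasure B := by
          rw [ENNReal.tsum_mul_right, PMF.tsum_coe, one_mul, PMF.toOuterMeasure_apply]
      _ ≤ fuel * ε + ε := by
          gcongr
          exact findGreedilyOptimal_failure hn₀ M hM
      _ = _ := by push_cast; ring

theorem le_toOuterMeasure_of_compl {β : Type*} (p : PMF β) {s : Set β} {ε : ℝ≥0∞}
    (h : p.toOuterMeasure sᶜ ≤ ε) : 1 - ε ≤ p.toOuterMeasure s := by
  have h1 : p.toOuterMeasure Set.univ = 1 :=
    (PMF.toOuterMeasure_apply_eq_one_iff _ _).2 (Set.subset_univ _)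
  rw [tsub_le_iff_right, ← h1, ← Set.union_compl_self s]
  exact (MeasureTheory.measure_union_le _ _).trans (by gcongr)

theorem natCast_mul_half_pow_le {m n : ℕ} (h : m ≤ n) :
    (m : ℝ≥0∞) * (1 / 2 : ℝ≥0∞) ^ (2 * n) ≤ (1 / 2) ^ n := by
  have h1 : (m : ℝ≥0∞) ≤ 2 ^ n := by
    exact_mod_cast h.trans Nat.lt_two_pow_self.le
  calc (m : ℝ≥0∞) * (1 / 2 : ℝ≥0∞) ^ (2 * n) ≤ 2 ^ n * (1 / 2 : ℝ≥0∞) ^ (2 * n) := by gcongr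
    _ = (1 / 2) ^ n := by
        rw [two_mul, pow_add, ← mul_assoc, ← mul_pow, one_div,
          ENNReal.mul_inv_cancel (by norm_num) (by norm_num), one_pow, one_mul]

/-! ### Matroids without small circuits -/

/-- Every dependent set has more than `50` elements. -/
def LargeCircuits (M : Matroid α) : Prop :=
  ∀ C ⊆ ground M, ¬ M.Indep (C : Set α) → 51 ≤ C.card

theorem disjoint_of_subset_ground_delete {M : Matroid α} {D : Set α} {T : Finset α}
    (hT : T ⊆ ground (M.delete D)) : Disjoint (T : Set α) D := by
  have := coe_subset_ground hT
  rw [Matroid.delete_ground, Set.subset_sdiff] at this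
  exact this.2

theorem delete_indep_iff_of_subset {M : Matroid α} {D : Set α} {T : Finset α}
    (hT : T ⊆ ground (M.delete D)) : (M.delete D).Indep (T : Set α) ↔ M.Indep (T : Set α) := by
  rw [Matroid.delete_indep_iff, and_iff_left (disjoint_of_subset_ground_delete hT)]

theorem ground_delete_subset (M : Matroid α) (D : Set α) : ground (M.delete D) ⊆ ground M :=
  ground_mono (by rw [Matroid.delete_ground]; exact Set.sdiff_subset)

theorem alpha_delete {M : Matroid α} {D : Set α} {T : Finset α}
    (hT : T ⊆ ground (M.delete D)) : alpha (M.delete D) T = alpha M T :=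
  alpha_congr fun _ hT' => delete_indep_iff_of_subset (hT'.trans hT)

theorem LargeCircuits.delete {M : Matroid α} (h : LargeCircuits M) (D : Set α) :
    LargeCircuits (M.delete D) := by
  intro C hC hdep
  rw [delete_indep_iff_of_subset hC] at hdep
  exact h C (hC.trans (ground_delete_subset M D)) hdep

/-- A surviving small dependent set would contain a circuit, whose element of least label has been
deleted. -/
theorem largeCircuits_removeSmallCircuits (π : α ↪ ℕ) (M : Matroid α) :
    LargeCircuits (removeSmallCircuits π M) := by
  classical
  intro C hC hdep
  by_contra hcard
  unfold removeSmallCircuits at hC hdep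
  have hCM := hC.trans (ground_delete_subset M _)
  have hdisj := disjoint_of_subset_ground_delete hC
  rw [delete_indep_iff_of_subset hC] at hdep
  have hDep : M.Dep (C : Set α) := ⟨hdep, coe_subset_ground hCM⟩
  obtain ⟨X, hXC, hX⟩ := hDep.exists_isCircuit_subset
  obtain ⟨Y, rfl⟩ : ∃ Y : Finset α, (Y : Set α) = X :=
    ⟨(C.finite_toSet.subset hXC).toFinset, by simp⟩
  have hYC : Y ⊆ C := by exact_mod_cast hXC
  have hYne : Y.Nonempty := by exact_mod_cast hX.nonempty
  obtain ⟨x, hxY, hxmin⟩ := Finset.exists_min_image Y π hYne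
  refine Set.disjoint_left.1 hdisj (Finset.mem_coe.2 (hYC hxY)) ?_
  refine ⟨Y, hYC.trans hCM, ?_, hxY, hxmin, ?_, hX.not_indep⟩
  · have := Finset.card_le_card hYC
    have := hYne.card_pos
    rw [Finset.mem_Icc]; omega
  · rw [Finset.coe_erase]
    exact hX.sdiff_singleton_indep hxY

/-! ### Properties of good runs -/

theorem alpha_bounds {M : Matroid α} (hM : LargeCircuits M) {S : Finset α} (hS : S ⊆ ground M)
    (hcap : Captures M S)
    (h1 : (alpha M S : ℝ) / (S.card : ℝ) < 1 / Real.logb 2 ((ground M).card : ℝ))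
    (h2 : (S.card : ℝ) ≤ ((ground M).card : ℝ) / 2) :
    51 ≤ alpha M S ∧ 9 * alpha M S ≤ S.card := by
  obtain ⟨C, hCS, hC⟩ := hcap.exists_dep_subset
  have hS51 : 51 ≤ S.card := (hM C (hCS.trans hS) hC).trans (Finset.card_le_card hCS)
  have hα : 51 ≤ alpha M S := lt_alpha M S (l := 50) (by omega) fun T hT hTc => by
    by_contra hdep
    have := hM T (hT.trans hS) hdep
    omega
  refine ⟨hα, ?_⟩
  have hS' : (51 : ℝ) ≤ S.card := by exact_mod_cast hS51
  have hα' : (51 : ℝ) ≤ alpha M S := by exact_mod_cast hα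
  set n : ℝ := ((ground M).card : ℝ)
  have key : ∀ k : ℕ, (2 : ℝ) ^ k ≤ n → (k : ℝ) * alpha M S ≤ S.card := by
    intro k hk
    rcases Nat.eq_zero_or_pos k with rfl | hk0
    · simp
    have hk0' : (0 : ℝ) < k := by exact_mod_cast hk0
    have hlog : (k : ℝ) ≤ Real.logb 2 n := by
      rw [Real.le_logb_iff_rpow_le (by norm_num) (by linarith), Real.rpow_natCast]
      exact hk
    have h3 : (alpha M S : ℝ) / S.card ≤ 1 / k :=
      h1.le.trans (one_div_le_one_div_of_le hk0' hlog)
    rw [div_le_div_iff₀ (by linarith) hk0'] at h3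
    linarith
  -- Bootstrap: `|S| ≥ 51` gives `n ≥ 102 ≥ 2 ^ 6`, hence `|S| ≥ 6 * 51`; then `n ≥ 612 ≥ 2 ^ 9`.
  have h6 := key 6 (by norm_num; linarith)
  have h9 := key 9 (by norm_num at h6 ⊢; linarith)
  exact_mod_cast h9

theorem GoodRun.mem_and_pairwise {M : Matroid α} {L : List (Finset α)} (hL : GoodRun M L)
    (hM : LargeCircuits M) :
    (∀ S ∈ L, S ⊆ ground M ∧ 51 ≤ alpha M S ∧ 9 * alpha M S ≤ S.card) ∧
    L.Pairwise (fun S T => Disjoint S T ∧ (S.card ≤ 2 * T.card →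
      (alpha M S : ℝ) * T.card / S.card
        + 1 / (5 * √2) * √((alpha M S : ℝ) * T.card / S.card) ≤ (alpha M T : ℝ))) := by
  induction L generalizing M with
  | nil => simp
  | cons S L ih =>
    obtain ⟨hS, hcap, h1, h2, hrun⟩ := hL
    obtain ⟨hmem, hpair⟩ := ih hrun (hM.delete _)
    have hSb := alpha_bounds hM hS hcap h1 h2
    have hsub := ground_delete_subset M (S : Set α)
    have hmem' : ∀ T ∈ L, T ⊆ ground M ∧ 51 ≤ alpha M T ∧ 9 * alpha M T ≤ T.card := by
      intro T hT
      obtain ⟨t1, t2⟩ := hmem T hT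
      rw [alpha_delete t1] at t2
      exact ⟨t1.trans hsub, t2⟩
    refine ⟨?_, ?_⟩
    · intro T hT
      rcases List.mem_cons.1 hT with rfl | hT
      · exact ⟨hS, hSb⟩
      · exact hmem' T hT
    · refine List.pairwise_cons.2 ⟨fun T hT => ?_, ?_⟩
      · have hdisj : Disjoint S T := by
          have := disjoint_of_subset_ground_delete (hmem T hT).1
          exact (Finset.disjoint_coe.1 this).symm
        obtain ⟨t1, t2, t3⟩ := hmem' T hT
        exact ⟨hdisj, fun hc => alpha_growth_of_captures hS t1 hdisj hcap hSb.1 (by omega)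
          hSb.2 t3 hc⟩
      · refine hpair.imp_of_mem fun {T T'} hT hT' hr => ?_
        rw [alpha_delete (hmem T hT).1, alpha_delete (hmem T' hT').1] at hr
        exact hr

/-! ### Size classes -/

theorem mul_card_le_of_step {ι : Type*} [LinearOrder ι] {y : ι → ℝ} {d : ℝ} (s : Finset ι)
    (h0 : ∀ i ∈ s, d ≤ y i) (h1 : ∀ i ∈ s, ∀ j ∈ s, i < j → y i + d ≤ y j) (hs : s.Nonempty) :
    d * s.card ≤ y (s.max' hs) := by
  induction s using Finset.induction_on_max with
  | empty => exact absurd hs Finset.not_nonempty_empty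
  | insert a s ha ih =>
    have hmax : (insert a s).max' hs = a := by
      refine le_antisymm (Finset.max'_le _ _ _ fun x hx => ?_)
        (Finset.le_max' _ _ (Finset.mem_insert_self _ _))
      rcases Finset.mem_insert.1 hx with rfl | hx
      · exact le_rfl
      · exact (ha x hx).le
    have hna : a ∉ s := fun h => lt_irrefl _ (ha a h)
    rw [hmax, Finset.card_insert_of_notMem hna]
    push_cast
    rcases s.eq_empty_or_nonempty with rfl | hne
    · simpa using h0 a (Finset.mem_insert_self _ _)
    · have h2 := ih (fun i hi => h0 i (Finset.mem_insert_of_mem hi))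
        (fun i hi j hj => h1 i (Finset.mem_insert_of_mem hi) j (Finset.mem_insert_of_mem hj)) hne
      have h3 := h1 _ (Finset.mem_insert_of_mem (s.max'_mem hne)) a (Finset.mem_insert_self _ _)
        (ha _ (s.max'_mem hne))
      linarith

theorem le_inv_five_sqrt_two : 0.14 ≤ 1 / (5 * √2) := by
  have h : √2 ≤ 1.4143 := by
    rw [Real.sqrt_le_left (by norm_num)]; norm_num
  rw [le_div_iff₀ (by positivity)]
  linarith

/-- One growth step in terms of the square roots of the normalized densities. -/
theorem sqrt_density_step {f g s t A : ℝ} (hf : 51 ≤ f) (hs : 0 < s) (ht : 0 < t) (hsA : s ≤ A)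
    (htA : t ≤ A) (h : f * t / s + 1 / (5 * √2) * √(f * t / s) ≤ g) :
    √(f * A / s) + 1 / 20 ≤ √(g * A / t) := by
  have hA : 0 < A := by linarith
  set y := √(f * A / s) with hy
  have hy2 : y ^ 2 = f * A / s := Real.sq_sqrt (by positivity)
  have hy0 : 0 ≤ y := Real.sqrt_nonneg _
  have hy51 : 51 ≤ y ^ 2 := by
    rw [hy2, le_div_iff₀ hs]; nlinarith
  have hy1 : 1 ≤ y := by nlinarith
  have e1 : f * t / s = y ^ 2 * (t / A) := by rw [hy2]; field_simp
  have h1 : y * (t / A) ≤ √(f * t / s) := by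
    refine Real.le_sqrt_of_sq_le ?_
    rw [e1, mul_pow]
    have h3 : 0 ≤ t / A := by positivity
    have h4 : t / A ≤ 1 := (div_le_one hA).2 htA
    have : (t / A) ^ 2 ≤ t / A := by nlinarith
    gcongr
  have h2 : 0.14 * (y * (t / A)) ≤ 1 / (5 * √2) * √(f * t / s) := by
    gcongr
    exact le_inv_five_sqrt_two
  refine Real.le_sqrt_of_sq_le ?_
  have h5 : (y ^ 2 + 0.14 * y) * (t / A) ≤ g := by
    rw [e1] at h h2
    linarith
  have h6 : y ^ 2 + 0.14 * y ≤ g * A / t := by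
    rw [le_div_iff₀ ht]
    rw [← mul_div_assoc, div_le_iff₀ hA] at h5
    exact h5
  -- `(y + 1/20)² = y² + 0.1 y + 1/400`, which is at most `y² + 0.14 y` because `y ≥ 1`.
  nlinarith

theorem mem_sizeClass {L : List (Finset α)} {l : ℕ} {i : Fin L.length} :
    i ∈ sizeClass L l ↔ 2 ^ l ≤ (L.get i).card ∧ (L.get i).card < 2 ^ (l + 1) := by
  have : 0 < 2 ^ (l + 1) := by positivity
  simp only [sizeClass, Finset.mem_filter, Finset.mem_univ, true_and, Finset.mem_Icc]
  omega

section Classes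

variable {M : Matroid α} {L : List (Finset α)}

/-- Normalizing by `2^(l+1)`, the last square root is at least `γ / 20`. Since `|S| ≥ 2^l`, this
gives `γ² ≤ 800 α`; then `9 α ≤ |S| ≤ 2^(l+1)` gives `γ² ≤ (1600 / 9) 2^l ≤ 14² * 2^l`. -/
theorem sizeClass_bounds
    (hmem : ∀ i : Fin L.length, 51 ≤ alpha M (L.get i) ∧ 9 * alpha M (L.get i) ≤ (L.get i).card)
    (hgrow : AlphaGrowth M L) {l : ℕ} (h : (sizeClass L l).Nonempty) :
    1 / 800 * ((sizeClass L l).card : ℝ) ^ 2 ≤ (alpha M (L.get ((sizeClass L l).max' h)) : ℝ) ∧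
      ((sizeClass L l).card : ℝ) ≤ 14 * √((2 : ℝ) ^ l) := by
  have hreal : ∀ i ∈ sizeClass L l, (2 : ℝ) ^ l ≤ (L.get i).card ∧
      ((L.get i).card : ℝ) ≤ 2 ^ (l + 1) := by
    intro i hi
    obtain ⟨h1, h2⟩ := mem_sizeClass.1 hi
    exact ⟨by exact_mod_cast h1, by exact_mod_cast h2.le⟩
  have h2l : (0 : ℝ) < 2 ^ l := by positivity
  have hα : ∀ i, (51 : ℝ) ≤ alpha M (L.get i) := fun i => by exact_mod_cast (hmem i).1
  set y : Fin L.length → ℝ := fun i => √((alpha M (L.get i) : ℝ) * 2 ^ (l + 1) / (L.get i).card)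
    with hy
  have h0 : ∀ i ∈ sizeClass L l, (1 / 20 : ℝ) ≤ y i := by
    intro i hi
    obtain ⟨h1, h2⟩ := hreal i hi
    refine Real.le_sqrt_of_sq_le ?_
    rw [le_div_iff₀ (by linarith)]
    nlinarith [hα i]
  have h1 : ∀ i ∈ sizeClass L l, ∀ j ∈ sizeClass L l, i < j → y i + 1 / 20 ≤ y j := by
    intro i hi j hj hij
    obtain ⟨i1, i2⟩ := hreal i hi
    obtain ⟨j1, j2⟩ := hreal j hj
    refine sqrt_density_step (hα i) (by linarith) (by linarith) i2 j2 (hgrow i j hij ?_)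
    have a1 := (mem_sizeClass.1 hi).2
    have a2 := (mem_sizeClass.1 hj).1
    rw [pow_succ] at a1
    omega
  have h2 := mul_card_le_of_step (sizeClass L l) h0 h1 h
  have hmax := Finset.max'_mem _ h
  set i := (sizeClass L l).max' h
  set γ := ((sizeClass L l).card : ℝ) with hγ
  have hγ0 : 0 ≤ γ := by positivity
  obtain ⟨i1, i2⟩ := hreal i hmax
  have hc0 : (0 : ℝ) < (L.get i).card := by linarith
  have hy2 : y i ^ 2 = (alpha M (L.get i) : ℝ) * 2 ^ (l + 1) / (L.get i).card :=
    Real.sq_sqrt (by positivity)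
  have hsq : (1 / 20 * γ) ^ 2 ≤ y i ^ 2 := by gcongr
  rw [hy2, le_div_iff₀ hc0, pow_succ (2 : ℝ) l] at hsq
  have hmain : 1 / 800 * γ ^ 2 ≤ (alpha M (L.get i) : ℝ) := by
    have h3 : (1 / 20 * γ) ^ 2 * 2 ^ l ≤ (alpha M (L.get i) : ℝ) * (2 ^ l * 2) :=
      le_trans (by gcongr) hsq
    have h4 : (1 / 800 * γ ^ 2) * 2 ^ l ≤ (alpha M (L.get i) : ℝ) * 2 ^ l := by linarith
    exact le_of_mul_le_mul_right h4 h2l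
  refine ⟨hmain, ?_⟩
  have h9 : 9 * (alpha M (L.get i) : ℝ) ≤ (L.get i).card := by exact_mod_cast (hmem i).2
  rw [pow_succ] at i2
  refine le_of_sq_le_sq ?_ (by positivity)
  rw [mul_pow, Real.sq_sqrt h2l.le]
  linarith

/-- The cut is the power of two just below `n^(2/3)`, where both counts are of order `n^(1/3)`: at
most `2 r` large sets by total size, and `35 r` small ones by a geometric sum over size classes. -/
theorem length_le {n : ℕ} (hn : (L.map Finset.card).sum ≤ n) (hpos : ∀ S ∈ L, 1 ≤ S.card)
    (hclass : ∀ l, ((sizeClass L l).card : ℝ) ≤ 14 * √((2 : ℝ) ^ l)) :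
    (L.length : ℝ) ≤ 40 * (n : ℝ) ^ (1 / 3 : ℝ) := by
  classical
  rcases Nat.eq_zero_or_pos n with rfl | hn0
  · have : L = [] := by
      rcases L with _ | ⟨S, L⟩
      · rfl
      · have := hpos S (by simp)
        simp only [List.map_cons, List.sum_cons] at hn
        omega
    subst this
    simp
  set r := (n : ℝ) ^ (1 / 3 : ℝ) with hr
  have hn1 : (1 : ℝ) ≤ n := by exact_mod_cast hn0
  have hr1 : 1 ≤ r := Real.one_le_rpow hn1 (by norm_num)
  have hr3 : r ^ 3 = n := by
    rw [hr, ← Real.rpow_natCast, ← Real.rpow_mul (by positivity)]; norm_num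
  obtain ⟨p, hp1, hp2⟩ := exists_nat_pow_near (show (1 : ℝ) ≤ r ^ 2 by nlinarith)
    (show (1 : ℝ) < 2 by norm_num)
  let big : Finset (Fin L.length) := Finset.univ.filter (fun i => 2 ^ p ≤ (L.get i).card)
  let small : Finset (Fin L.length) := Finset.univ.filter (fun i => ¬ 2 ^ p ≤ (L.get i).card)
  have hsplit : (L.length : ℝ) = big.card + small.card := by
    have := Finset.card_filter_add_card_filter_not (s := (Finset.univ : Finset (Fin L.length)))
      (fun i => 2 ^ p ≤ (L.get i).card)
    rw [Finset.card_univ, Fintype.card_fin] at this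
    exact_mod_cast this.symm
  have hbig : (big.card : ℝ) ≤ 2 * r := by
    have h1 : big.card * 2 ^ p ≤ n := by
      calc big.card * 2 ^ p = ∑ i ∈ big, 2 ^ p := by rw [Finset.sum_const, smul_eq_mul]
        _ ≤ ∑ i ∈ big, (L.get i).card := Finset.sum_le_sum fun i hi => (Finset.mem_filter.1 hi).2
        _ ≤ ∑ i : Fin L.length, (L.get i).card :=
            Finset.sum_le_sum_of_subset (Finset.subset_univ _)
        _ = (L.map Finset.card).sum := by
            rw [← Fin.sum_univ_fun_getElem]; rfl
        _ ≤ n := hn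
    have h1' : (big.card : ℝ) * 2 ^ p ≤ n := by exact_mod_cast h1
    rw [← hr3] at h1'
    rw [pow_succ (2 : ℝ) p] at hp2
    have h2 : (big.card : ℝ) * 2 ^ p ≤ (2 * r) * 2 ^ p := by nlinarith
    exact le_of_mul_le_mul_right h2 (by positivity)
  have hsmall : (small.card : ℝ) ≤ 35 * r := by
    have h1 : small ⊆ (Finset.range p).biUnion (sizeClass L) := by
      intro i hi
      have hi' : (L.get i).card < 2 ^ p := not_le.1 (Finset.mem_filter.1 hi).2
      have h0 : (L.get i).card ≠ 0 := by
        have := hpos (L.get i) (List.get_mem L i)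
        omega
      refine Finset.mem_biUnion.2 ⟨Nat.log 2 (L.get i).card, ?_, mem_sizeClass.2
        ⟨Nat.pow_log_le_self 2 h0, Nat.lt_pow_succ_log_self (by norm_num) _⟩⟩
      rw [Finset.mem_range]
      exact Nat.log_lt_of_lt_pow h0 hi'
    have h2 : (small.card : ℝ) ≤ ∑ l ∈ Finset.range p, ((sizeClass L l).card : ℝ) := by
      exact_mod_cast (Finset.card_le_card h1).trans Finset.card_biUnion_le
    -- The induction needs `2.5 + 1 ≤ 2.5 √2`, which already holds with `1.4` for `√2`.
    have h3 : ∀ q : ℕ, ∑ l ∈ Finset.range q, √((2 : ℝ) ^ l) ≤ 2.5 * √((2 : ℝ) ^ q) := by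
      intro q
      induction q with
      | zero => norm_num
      | succ q ih =>
        rw [Finset.sum_range_succ, pow_succ, Real.sqrt_mul (by positivity)]
        have h4 : 1.4 ≤ √2 := Real.le_sqrt_of_sq_le (by norm_num)
        have h5 : 0 ≤ √((2 : ℝ) ^ q) := Real.sqrt_nonneg _
        nlinarith
    have h4 : √((2 : ℝ) ^ p) ≤ r := by
      rw [Real.sqrt_le_left (by linarith)]; exact hp1
    calc (small.card : ℝ) ≤ ∑ l ∈ Finset.range p, ((sizeClass L l).card : ℝ) := h2
      _ ≤ ∑ l ∈ Finset.range p, 14 * √((2 : ℝ) ^ l) := Finset.sum_le_sum fun l _ => hclass l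
      _ = 14 * ∑ l ∈ Finset.range p, √((2 : ℝ) ^ l) := by rw [Finset.mul_sum]
      _ ≤ 14 * (2.5 * √((2 : ℝ) ^ p)) := by gcongr; exact h3 p
      _ ≤ 35 * r := by linarith
  rw [hsplit]
  linarith

theorem sum_card_le_of_pairwise_disjoint {E : Finset α} (hsub : ∀ S ∈ L, S ⊆ E)
    (hdisj : L.Pairwise Disjoint) : (L.map Finset.card).sum ≤ E.card := by
  induction L generalizing E with
  | nil => simp
  | cons S L ih =>
    rw [List.pairwise_cons] at hdisj
    have h1 := ih (E := E \ S) (fun T hT => by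
      rw [Finset.subset_sdiff]
      exact ⟨hsub T (List.mem_cons_of_mem _ hT), (hdisj.1 T hT).symm⟩) hdisj.2
    have hS := hsub S List.mem_cons_self
    rw [Finset.card_sdiff_of_subset hS] at h1
    have := Finset.card_le_card hS
    simp only [List.map_cons, List.sum_cons]
    omega

end Classes

/-! ### Return to the original matroid and conclusion. -/

theorem card_ground (M : Matroid α) : (ground M).card = M.E.ncard := by
  rw [← coe_ground, Set.ncard_coe_finset]

theorem GoodRun.properties {M : Matroid α} {π : α ↪ ℕ} {L : List (Finset α)}
    (hL : GoodRun (removeSmallCircuits π M) L) :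
    AlphaGrowth M L ∧
      (∀ l : ℕ, (∀ h : (sizeClass L l).Nonempty, 1 / 800 * ((sizeClass L l).card : ℝ) ^ 2 ≤
          (alpha M (L.get ((sizeClass L l).max' h)) : ℝ)) ∧
        ((sizeClass L l).card : ℝ) ≤ 40 * √((2 : ℝ) ^ l)) ∧
      (L.length : ℝ) ≤ 40 * (M.E.ncard : ℝ) ^ (1 / 3 : ℝ) := by
  obtain ⟨hmem, hpair⟩ := hL.mem_and_pairwise (largeCircuits_removeSmallCircuits π M)
  have hα : ∀ S ∈ L, alpha (removeSmallCircuits π M) S = alpha M S :=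
    fun S hS => alpha_delete (hmem S hS).1
  have hmem' : ∀ i : Fin L.length,
      51 ≤ alpha M (L.get i) ∧ 9 * alpha M (L.get i) ≤ (L.get i).card := by
    intro i
    have := (hmem _ (List.get_mem L i)).2
    rwa [hα _ (List.get_mem L i)] at this
  have hgrow : AlphaGrowth M L := by
    intro i j hij hc
    have := (List.pairwise_iff_get.1 hpair i j hij).2 hc
    rwa [hα _ (List.get_mem L i), hα _ (List.get_mem L j)] at this
  have hclass : ∀ l, ((sizeClass L l).card : ℝ) ≤ 14 * √((2 : ℝ) ^ l) := by
    intro l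
    rcases (sizeClass L l).eq_empty_or_nonempty with h | h
    · rw [h]; simp
    · exact (sizeClass_bounds hmem' hgrow h).2
  refine ⟨hgrow, fun l => ⟨fun h => (sizeClass_bounds hmem' hgrow h).1, ?_⟩, ?_⟩
  · refine (hclass l).trans ?_
    gcongr
    norm_num
  · refine length_le ?_ (fun S hS => ?_) hclass
    · rw [← card_ground]
      exact sum_card_le_of_pairwise_disjoint
        (fun S hS => (hmem S hS).1.trans (ground_delete_subset M _)) (hpair.imp fun h => h.1)
    · have := (hmem S hS).2
      omega

end MatroidPeel

theorem mainTheorem4 :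
    ∃ (c C : ℝ) (N₀ : ℕ), 0 < c ∧ 0 < C ∧
      ∀ {α : Type*} [Fintype α] [LinearOrder α] (M : Matroid α) (π : α ↪ ℕ) (n₀ : ℕ),
        N₀ ≤ n₀ → M.E.ncard ≤ n₀ →
        1 - (1 / 2 : ℝ≥0∞) ^ n₀ ≤
          (MatroidPeel.iterativePeel n₀ π M).toOuterMeasure
            {L : List (Finset α) |
              MatroidPeel.AlphaGrowth M L ∧
              (∀ l : ℕ,
                (∀ h : (MatroidPeel.sizeClass L l).Nonempty,
                  c * ((MatroidPeel.sizeClass L l).card : ℝ) ^ 2 ≤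
                    (MatroidPeel.alpha M (L.get ((MatroidPeel.sizeClass L l).max' h)) : ℝ)) ∧
                ((MatroidPeel.sizeClass L l).card : ℝ) ≤ C * √((2 : ℝ) ^ l)) ∧
              (L.length : ℝ) ≤ C * (M.E.ncard : ℝ) ^ (1 / 3 : ℝ)} := by
  -- `40` covers both `14` for the size classes and `2 + 35` for the length; `8` is what the
  -- concentration bound requires of `n₀`.
  refine ⟨1 / 800, 40, 8, by norm_num, by norm_num, ?_⟩
  intro α _ _ M π n₀ hn₀ hM
  rw [← MatroidPeel.card_ground] at hM
  have hM' : (MatroidPeel.ground (MatroidPeel.removeSmallCircuits π M)).card ≤ n₀ :=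
    (Finset.card_le_card (MatroidPeel.ground_delete_subset M _)).trans hM
  refine MatroidPeel.le_toOuterMeasure_of_compl _ ?_
  refine le_trans (MeasureTheory.measure_mono ?_)
    ((MatroidPeel.peelLoop_failure hn₀ (MatroidPeel.ground M).card _ hM').trans
      (MatroidPeel.natCast_mul_half_pow_le hM))
  intro L hL hgood
  exact hL hgood.properties
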